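/- Let $F\in\mathbb R^{m\times n}$, $y\in\mathbb R^m$, $\beta>0$, $\tau>0$. For $\gamma\in\mathbb R^n_{+}=\{\gamma:\gamma_i\ge 0\}$ put $$S(\gamma)=\beta^{-1}I+F\,\mathrm{diag}(\gamma)F^{\mathsf T},\qquad L(\gamma)=y^{\mathsf T}S(\gamma)^{-1}y+\log\det S(\gamma),$$ and for $\theta\in\mathbb R^n_{++}=\{\theta:\theta_i>0\}$ put $\Psi(\theta)=\log\det S(\theta^{-2})$, where $\theta^{-2}$ is taken componentwise. For $x\in\mathbb R^n$ and $\gamma\in\mathbb R^n_{++}$ let $\Phi(x,\gamma)=\beta\|Fx-y\|^2+\sum_{i=1}^n x_i^2/\gamma_i$. Given $\gamma^{(0)}\in\mathbb R^n_{++}$ and step sizes $\eta^{(k)}>0$, the AMQ iteration generates $\theta^{(k)}\in\mathbb R^n_{++}$ and $\gamma^{(k)}=(\theta^{(k)})^{-2}$, $k\ge 0$, by $$x^{(k)}=\operatorname*{arg\,min}_{x\in\mathbb R^n}\Phi(x,\gamma^{(k)}),$$ $$\theta^{(k+\frac12)}=\operatorname*{arg\,min}_{\theta\in\mathbb R^n_{++}}\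 \Phi(x^{(k)},\theta^{-2})+\Psi(\theta^{(k)})+\langle\nabla\Psi(\theta^{(k)}),\theta-\theta^{(k)}\rangle+\tfrac{\tau}{2}\|\theta-\theta^{(k)}\|^2,$$ $$\theta^{(k+1)}=\theta^{(k)}+\eta^{(k)}\bigl(\theta^{(k+\frac12)}-\theta^{(k)}\bigr).$$ Call $R>0$ an iterate bound (for $F,y,\beta,\tau,\gamma^{(0)}$) if, for every choice of step sizes such that the AMQ sequence started at $\gamma^{(0)}$ satisfies $L(\gamma^{(k+1)})\le L(\gamma^{(k)})$ for all $k\ge 0$, one has $\gamma_i^{(k)}\le R$ for all $k\ge 0$ and $1\le i\le n$. For $k\ge 0$ put $$A_k=\eta^{(k)}\sum_{i=1}^n\bigl[(x_i^{(k)})^2+\tau\bigr]\bigl(\theta_i^{(k+\frac12)}-\theta_i^{(k)}\bigr)^2,\qquad B_k=(\eta^{(k)})^2\sum_{i=1}^n\bigl[(x_i^{(k)})^2+\tfrac{9R}{5}\bigr]\bigl(\theta_i^{(k+\frac12)}-\theta_i^{(k)}\bigr)^2 .$$ **Theorem.** An iterate bound $R$ exists. Let $R$ be any iterate bound, and let the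 AMQ sequence with initial point $\gamma^{(0)}\in\mathbb R^n_{++}$ and step sizes $\eta^{(k)}>0$ satisfy $B_k\le A_k$ for all $k\ge 0$. Then: 1. The sequence $\{L(\gamma^{(k)})\}$ is monotonically decreasing (non-increasing) and converges. 2. There is a subsequence $\{n_k\}$ of $\mathbb N$ such that both $\{x^{(n_k)}\}$ and $\{\gamma^{(n_k)}\}$ converge. 3. Let $\{n_k\}$ be any subsequence along which $\gamma^{(n_k)}$ converges, with limit $\gamma^*$. If $\sum_{k=0}^\infty\eta^{(n_k)}=\infty$ and there is a constant $\kappa\in[0,1)$ with $B_k\le\kappa A_k$ for all $k\ge 0$, then for each $1\le i\le n$ either $\gamma_i^*=0$ or $\frac{\partial L}{\partial\gamma_i}(\gamma^*)=0$. -/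

import Mathlib

open Filter Topology Matrix

/-- The marginal covariance `S(γ) = β⁻¹ I + F diag(γ) Fᵀ`. -/
noncomputable def marginalCov {m n : ℕ} (F : Matrix (Fin m) (Fin n) ℝ) (β : ℝ)
    (γ : Fin n → ℝ) : Matrix (Fin m) (Fin m) ℝ :=
  β⁻¹ • (1 : Matrix (Fin m) (Fin m) ℝ) + F * Matrix.diagonal γ * Fᵀ

/-- The log-determinant term `g(γ) = log det S(γ)`. -/
noncomputable def logDetTerm {m n : ℕ} (F : Matrix (Fin m) (Fin n) ℝ) (β : ℝ)
    (γ : Fin n → ℝ) : ℝ :=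
  Real.log (marginalCov F β γ).det

/-- The type-II likelihood objective `L(γ) = yᵀ S(γ)⁻¹ y + log det S(γ)`. -/
noncomputable def evidenceObjective {m n : ℕ} (F : Matrix (Fin m) (Fin n) ℝ) (y : Fin m → ℝ)
    (β : ℝ) (γ : Fin n → ℝ) : ℝ :=
  y ⬝ᵥ ((marginalCov F β γ)⁻¹ *ᵥ y) + logDetTerm F β γ

/-- The function `F(x, γ) = β ‖F x - y‖² + ∑ᵢ xᵢ² / γᵢ` of the auxiliary variable `x`. It is only
used for `γ` with positive entries, where the terms for vanishing entries of `γ` do not occur. -/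
noncomputable def auxObjective {m n : ℕ} (F : Matrix (Fin m) (Fin n) ℝ) (y : Fin m → ℝ)
    (β : ℝ) (x γ : Fin n → ℝ) : ℝ :=
  β * ∑ j, ((F *ᵥ x) j - y j) ^ 2 + ∑ i, x i ^ 2 / γ i

/-- The componentwise change of variable `θ ↦ θ⁻²`. -/
noncomputable def invSq {n : ℕ} (θ : Fin n → ℝ) : Fin n → ℝ :=
  fun i => (θ i ^ 2)⁻¹

/-- The open positive orthant. -/
def posOrthant (n : ℕ) : Set (Fin n → ℝ) :=
  {θ | ∀ i, 0 < θ i}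

/-- `Ψ(θ) = g(θ⁻²)`. -/
noncomputable def logDetTheta {m n : ℕ} (F : Matrix (Fin m) (Fin n) ℝ) (β : ℝ)
    (θ : Fin n → ℝ) : ℝ :=
  logDetTerm F β (invSq θ)

/-- The quadratic surrogate of `Ψ` at `θ₀`:
`Ψ(θ₀) + ⟨∇Ψ(θ₀), θ - θ₀⟩ + (τ / 2) ‖θ - θ₀‖²`, with the Euclidean norm. -/
noncomputable def proxSurrogate {m n : ℕ} (F : Matrix (Fin m) (Fin n) ℝ) (β τ : ℝ)
    (θ₀ θ : Fin n → ℝ) : ℝ :=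
  logDetTheta F β θ₀ + fderiv ℝ (logDetTheta F β) θ₀ (θ - θ₀)
    + τ / 2 * ∑ i, (θ i - θ₀ i) ^ 2

/-- A run of the AMQ iteration with initial point `γ₀`: step sizes `η`, iterates `θ` (so that
`γ = θ⁻²`), intermediate points `θHalf k = θ^(k+1/2)` and auxiliary vectors `x`. -/
structure AMQRun {m n : ℕ} (F : Matrix (Fin m) (Fin n) ℝ) (y : Fin m → ℝ) (β τ : ℝ)
    (γ₀ : Fin n → ℝ) where
  η : ℕ → ℝ
  θ : ℕ → Fin n → ℝ
  θHalf : ℕ → Fin n → ℝ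
  x : ℕ → Fin n → ℝ
  η_pos : ∀ k, 0 < η k
  θ_mem : ∀ k, θ k ∈ posOrthant n
  init : invSq (θ 0) = γ₀
  x_update : ∀ k, IsMinOn (fun z => auxObjective F y β z (invSq (θ k))) Set.univ (x k)
  θHalf_mem : ∀ k, θHalf k ∈ posOrthant n
  θHalf_update : ∀ k,
    IsMinOn (fun ϑ => auxObjective F y β (x k) (invSq ϑ) + proxSurrogate F β τ (θ k) ϑ)
      (posOrthant n) (θHalf k)
  θ_update : ∀ k, θ (k + 1) = θ k + η k • (θHalf k - θ k)

namespace AMQRun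

variable {m n : ℕ} {F : Matrix (Fin m) (Fin n) ℝ} {y : Fin m → ℝ} {β τ : ℝ} {γ₀ : Fin n → ℝ}

/-- The hyperparameter iterates `γ^(k) = (θ^(k))⁻²`. -/
noncomputable def γ (r : AMQRun F y β τ γ₀) (k : ℕ) : Fin n → ℝ :=
  invSq (r.θ k)

/-- The objective values `L(γ^(k))`. -/
noncomputable def objective (r : AMQRun F y β τ γ₀) (k : ℕ) : ℝ :=
  evidenceObjective F y β (r.γ k)

/-- `A_k = η_k ∑ᵢ (xᵢ² + τ) (θᵢ^(k+1/2) - θᵢ^(k))²`. -/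
noncomputable def A (r : AMQRun F y β τ γ₀) (k : ℕ) : ℝ :=
  r.η k * ∑ i, (r.x k i ^ 2 + τ) * (r.θHalf k i - r.θ k i) ^ 2

/-- `B_k = η_k² ∑ᵢ (xᵢ² + 9 R / 5) (θᵢ^(k+1/2) - θᵢ^(k))²`. -/
noncomputable def B (r : AMQRun F y β τ γ₀) (R : ℝ) (k : ℕ) : ℝ :=
  r.η k ^ 2 * ∑ i, (r.x k i ^ 2 + 9 * R / 5) * (r.θHalf k i - r.θ k i) ^ 2

end AMQRun

/-- `R` is a positive constant bounding all entries of all iterates `γ^(k)`, for every choice of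
the step sizes (from the initial point `γ₀`) along which the objective never increases. -/
def IsIterateBound {m n : ℕ} (F : Matrix (Fin m) (Fin n) ℝ) (y : Fin m → ℝ) (β τ : ℝ)
    (γ₀ : Fin n → ℝ) (R : ℝ) : Prop :=
  0 < R ∧ ∀ r : AMQRun F y β τ γ₀, (∀ k, r.objective (k + 1) ≤ r.objective k) →
    ∀ k i, r.γ k i ≤ R

/-!
# Convergence of the AMQ iteration

Write `hᵢ = fᵢᵀ S(γ)⁻¹ fᵢ` and `pᵢ = γᵢ hᵢ`, where `fᵢ` is the `i`-th column of `F`. The proof rests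
on a global quadratic upper bound for `Ψ(θ) = log det S(θ⁻²)` that avoids second derivatives
(`logDetTheta_le_quadratic`): with `d = θ' - θ` and `C` any upper bound for `γ` and `γ'`,
`Ψ(θ') ≤ Ψ(θ) + ⟨∇Ψ(θ), d⟩ + (3/2) ∑ᵢ Cᵢ dᵢ²`.
Concavity of `log det` gives two tangent-plane inequalities, one in the covariance `S`, which is
affine in `γ`, and one in the precision matrix `diag(γ)⁻¹ + β Fᵀ F`, which is affine in `1 / γ`; the
Woodbury identity expresses both through `pᵢ ∈ [0, 1]`. Their second-order terms are at most
`3 pᵢ Cᵢ dᵢ²` and `(γᵢ (1 - pᵢ) + Cᵢ) dᵢ²`, and the weights `1/4` and `3/4` give `(3/2) Cᵢ dᵢ²`.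

Both inner minimizations have explicit unique solutions (`posteriorMean`, `proxPoint`), and
`yᵀ S(γ)⁻¹ y` is the minimum of the auxiliary objective. Hence the quadratic bound yields
`L(γ^(k+1)) ≤ L(γ^(k)) - A_k + B_k` as long as the values `γ` stay below `6 R / 5`, because
`(3/2) (6/5) = 9/5` (`evidenceObjective_step_le_sub`).

An iterate bound exists because `L` is coercive in each coordinate whose column of `F` is nonzero
and the other coordinates never move. An iterate bound only speaks of runs along which `L` never
increases, so monotonicity of `L` is proved by induction together with a continuity argument on the
segment from `θ^(k)` to `θ^(k+1)` (`IsIterateBound.objective_succ_le`). If a point of the segment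
has `γ ≤ 6 R / 5`, then `L` does not exceed its value at `θ^(k)` there; continuing from that point
with short descent steps gives a run to which the iterate bound applies, so in fact `γ ≤ R`.
Connectedness of the segment then gives `γ ≤ R` on all of it.

Finally, `B_k ≤ κ A_k` makes `∑ A_k` finite, so divergence of the step sizes forces the directions
to zero along a subsequence. In the limit the stationarity condition of the half step becomes
`(fᵢᵀ S⁻¹ y)² = hᵢ` wherever `γᵢ > 0`, and `hᵢ - (fᵢᵀ S⁻¹ y)²` is the partial derivative of `L`
(`hasDerivAt_evidenceObjective_update`).
-/

/-! ### Determinants of positive definite matrices -/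

section LogDet

variable {ι : Type*} [Fintype ι] [DecidableEq ι]

theorem Matrix.PosDef.log_det_le_trace_sub_card {M : Matrix ι ι ℝ} (hM : M.PosDef) :
    Real.log M.det ≤ M.trace - Fintype.card ι := by
  have hpos := hM.eigenvalues_pos
  rw [hM.isHermitian.det_eq_prod_eigenvalues, hM.isHermitian.trace_eq_sum_eigenvalues]
  simp only [RCLike.ofReal_real_eq_id, id_eq]
  rw [Real.log_prod (fun i _ => (hpos i).ne')]
  calc ∑ i, Real.log (hM.isHermitian.eigenvalues i)
      ≤ ∑ i, (hM.isHermitian.eigenvalues i - 1) :=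
        Finset.sum_le_sum fun i _ => Real.log_le_sub_one_of_pos (hpos i)
    _ = _ := by simp

open scoped MatrixOrder in
/-- The tangent-plane inequality for the concave function `log det` on the cone of positive
definite matrices. -/
theorem Matrix.PosDef.log_det_le_add_trace {A B : Matrix ι ι ℝ} (hA : A.PosDef) (hB : B.PosDef) :
    Real.log A.det ≤ Real.log B.det + (B⁻¹ * (A - B)).trace := by
  have hBi : B⁻¹.PosDef := hB.inv
  set C : Matrix ι ι ℝ := CFC.sqrt B⁻¹
  have hCC : C * C = B⁻¹ := CFC.sqrt_mul_sqrt_self B⁻¹ hBi.posSemidef.nonneg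
  have hCH : Cᴴ = C := (CFC.sqrt_nonneg B⁻¹).posSemidef.isHermitian
  have hBdet : 0 < B.det := hB.det_pos
  have hCdet : C.det * C.det * B.det = 1 := by
    rw [← det_mul, hCC, ← det_mul, nonsing_inv_mul _ hBdet.ne'.isUnit, det_one]
  have hC0 : C.det ≠ 0 := by
    rintro h
    simp [h] at hCdet
  have hM : (Cᴴ * A * C).PosDef := hA.conjTranspose_mul_mul_same
    (mulVec_injective_iff_isUnit.mpr ((isUnit_iff_isUnit_det _).mpr hC0.isUnit))
  have hdet : (Cᴴ * A * C).det * B.det = A.det := by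
    rw [hCH, det_mul, det_mul]
    linear_combination A.det * hCdet
  have htr : (Cᴴ * A * C).trace = (B⁻¹ * A).trace := by
    rw [hCH, trace_mul_comm, ← Matrix.mul_assoc, hCC]
  have hBB : (B⁻¹ * B).trace = Fintype.card ι := by
    rw [nonsing_inv_mul _ hBdet.ne'.isUnit, trace_one]
  have := hM.log_det_le_trace_sub_card
  rw [← hdet, Real.log_mul hM.det_pos.ne' hBdet.ne', Matrix.mul_sub, trace_sub, hBB, ← htr]
  linarith

open scoped MatrixOrder in
theorem Matrix.PosDef.log_det_mono {A B : Matrix ι ι ℝ} (hA : A.PosDef)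
    (hAB : (B - A).PosSemidef) : Real.log A.det ≤ Real.log B.det := by
  have hB : B.PosDef := by simpa using hA.add_posSemidef hAB
  have h := hA.log_det_le_add_trace hB
  set C : Matrix ι ι ℝ := CFC.sqrt B⁻¹
  have hCC : C * C = B⁻¹ := CFC.sqrt_mul_sqrt_self B⁻¹ hB.inv.posSemidef.nonneg
  have hCH : Cᴴ = C := (CFC.sqrt_nonneg B⁻¹).posSemidef.isHermitian
  have htr : (B⁻¹ * (B - A)).trace = (Cᴴ * (B - A) * C).trace := by
    rw [hCH, trace_mul_comm (C * (B - A)), ← Matrix.mul_assoc, hCC]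
  have h0 := (hAB.conjTranspose_mul_mul_same C).trace_nonneg
  rw [← htr] at h0
  have : (B⁻¹ * (A - B)).trace = -(B⁻¹ * (B - A)).trace := by
    rw [← trace_neg, ← Matrix.mul_neg, neg_sub]
  linarith

end LogDet

/-! ### The marginal covariance -/

section MarginalCov

variable {m n : ℕ} {F : Matrix (Fin m) (Fin n) ℝ} {β : ℝ}

/-- The quadratic forms `hᵢ(γ) = fᵢᵀ S(γ)⁻¹ fᵢ`, where `fᵢ` is the `i`-th column of `F`; they are
the partial derivatives of `log det S`. -/
noncomputable def columnForm (F : Matrix (Fin m) (Fin n) ℝ) (β : ℝ) (γ : Fin n → ℝ)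
    (i : Fin n) : ℝ :=
  (Fᵀ * (marginalCov F β γ)⁻¹ * F) i i

theorem posSemidef_mul_diagonal_mul_transpose {γ : Fin n → ℝ} (hγ : ∀ i, 0 ≤ γ i) :
    (F * diagonal γ * Fᵀ).PosSemidef := by
  have h : (diagonal γ).PosSemidef := posSemidef_diagonal_iff.mpr hγ
  simpa using h.mul_mul_conjTranspose_same F

theorem marginalCov_sub (γ γ' : Fin n → ℝ) :
    marginalCov F β γ' - marginalCov F β γ = F * diagonal (γ' - γ) * Fᵀ := by
  simp only [marginalCov, add_sub_add_left_eq_sub]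
  rw [← Matrix.sub_mul, ← Matrix.mul_sub, diagonal_sub]
  rfl

theorem posDef_marginalCov (hβ : 0 < β) {γ : Fin n → ℝ} (hγ : ∀ i, 0 ≤ γ i) :
    (marginalCov F β γ).PosDef :=
  (PosDef.one.smul (inv_pos.mpr hβ)).add_posSemidef (posSemidef_mul_diagonal_mul_transpose hγ)

theorem isUnit_det_marginalCov (hβ : 0 < β) {γ : Fin n → ℝ} (hγ : ∀ i, 0 ≤ γ i) :
    IsUnit (marginalCov F β γ).det :=
  (posDef_marginalCov hβ hγ).det_pos.ne'.isUnit

theorem columnForm_nonneg (hβ : 0 < β) {γ : Fin n → ℝ} (hγ : ∀ i, 0 ≤ γ i) (i : Fin n) :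
    0 ≤ columnForm F β γ i := by
  have h := (posDef_marginalCov (F := F) hβ hγ).inv.posSemidef.conjTranspose_mul_mul_same F
  rw [conjTranspose_eq_transpose_of_trivial] at h
  exact h.diag_nonneg

theorem columnForm_eq_zero {i : Fin n} (hi : ∀ j, F j i = 0) (γ : Fin n → ℝ) :
    columnForm F β γ i = 0 := by
  simp [columnForm, Matrix.mul_apply, hi]

theorem logDetTerm_le_add_sum (hβ : 0 < β) {γ γ' : Fin n → ℝ} (hγ : ∀ i, 0 ≤ γ i)
    (hγ' : ∀ i, 0 ≤ γ' i) :
    logDetTerm F β γ' ≤ logDetTerm F β γ + ∑ i, columnForm F β γ i * (γ' i - γ i) := by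
  refine ((posDef_marginalCov hβ hγ').log_det_le_add_trace
    (posDef_marginalCov (F := F) hβ hγ)).trans_eq ?_
  rw [marginalCov_sub, ← Matrix.mul_assoc, trace_mul_comm, ← Matrix.mul_assoc, ← Matrix.mul_assoc]
  simp [Matrix.trace, columnForm, logDetTerm, Matrix.mul_diagonal]

theorem logDetTerm_mono (hβ : 0 < β) {γ γ' : Fin n → ℝ} (hγ : ∀ i, 0 ≤ γ i)
    (hγγ' : ∀ i, γ i ≤ γ' i) : logDetTerm F β γ ≤ logDetTerm F β γ' := by
  refine (posDef_marginalCov hβ hγ).log_det_mono ?_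
  rw [marginalCov_sub]
  exact posSemidef_mul_diagonal_mul_transpose fun i => sub_nonneg.mpr (hγγ' i)

theorem det_marginalCov_single (hβ : β ≠ 0) (i : Fin n) (c : ℝ) :
    (marginalCov F β (Pi.single i c)).det = β⁻¹ ^ m * (1 + β * c * ∑ j, F j i ^ 2) := by
  have h : marginalCov F β (Pi.single i c) =
      β⁻¹ • (1 + replicateCol Unit (fun j => β * c * F j i) *
        replicateRow Unit (fun j => F j i)) := by
    ext a b
    simp only [marginalCov, Matrix.add_apply, Matrix.smul_apply, smul_eq_mul]
    rw [Matrix.mul_apply, Matrix.mul_apply]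
    simp only [Matrix.mul_diagonal, transpose_apply, replicateCol_apply, replicateRow_apply]
    rw [Finset.sum_eq_single i (fun k _ hk => by simp [hk]) (by simp)]
    simp
    field_simp
  rw [h, det_smul, det_one_add_replicateCol_mul_replicateRow, Fintype.card_fin]
  simp only [dotProduct, Finset.mul_sum]
  congr 2
  exact Finset.sum_congr rfl fun j _ => by ring

end MarginalCov

/-! ### The posterior precision matrix -/

section Precision

variable {m n : ℕ} {F : Matrix (Fin m) (Fin n) ℝ} {β : ℝ}

/-- The posterior precision matrix `diag(γ)⁻¹ + β Fᵀ F` of the auxiliary variable. -/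
noncomputable def precision (F : Matrix (Fin m) (Fin n) ℝ) (β : ℝ) (γ : Fin n → ℝ) :
    Matrix (Fin n) (Fin n) ℝ :=
  diagonal (fun i => (γ i)⁻¹) + β • (Fᵀ * F)

theorem posDef_precision (hβ : 0 < β) {γ : Fin n → ℝ} (hγ : ∀ i, 0 < γ i) :
    (precision F β γ).PosDef := by
  have h1 : (diagonal fun i => (γ i)⁻¹).PosDef := PosDef.diagonal fun i => inv_pos.mpr (hγ i)
  have h2 := (posSemidef_conjTranspose_mul_self F).smul hβ.le
  rw [conjTranspose_eq_transpose_of_trivial] at h2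
  exact h1.add_posSemidef h2

/-- The Woodbury identity. -/
theorem precision_inv (hβ : 0 < β) {γ : Fin n → ℝ} (hγ : ∀ i, 0 < γ i) :
    (precision F β γ)⁻¹ =
      diagonal γ - diagonal γ * Fᵀ * (marginalCov F β γ)⁻¹ * F * diagonal γ := by
  refine inv_eq_right_inv ?_
  set T := (marginalCov F β γ)⁻¹
  have hDD : diagonal (fun i => (γ i)⁻¹) * diagonal γ = 1 := by
    rw [diagonal_mul_diagonal, ← diagonal_one]
    congr 1
    ext i
    exact inv_mul_cancel₀ (hγ i).ne'
  set D := diagonal γ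
  have hST : F * D * Fᵀ * T = 1 - β⁻¹ • T := by
    have h : marginalCov F β γ * T = 1 :=
      mul_nonsing_inv _ (isUnit_det_marginalCov hβ fun i => (hγ i).le)
    rw [marginalCov, Matrix.add_mul, Matrix.smul_mul, Matrix.one_mul] at h
    rw [← h, add_sub_cancel_left]
  have h1 : diagonal (fun i => (γ i)⁻¹) * (D * Fᵀ * T * F * D) = Fᵀ * T * F * D := by
    rw [show D * Fᵀ * T * F * D = D * (Fᵀ * T * F * D) by simp only [Matrix.mul_assoc],
      ← Matrix.mul_assoc, hDD, Matrix.one_mul]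
  have h2 : Fᵀ * F * (D * Fᵀ * T * F * D) = Fᵀ * F * D - β⁻¹ • (Fᵀ * T * F * D) := by
    calc Fᵀ * F * (D * Fᵀ * T * F * D) = Fᵀ * (F * D * Fᵀ * T) * F * D := by
          simp only [Matrix.mul_assoc]
      _ = _ := by
          rw [hST, Matrix.mul_sub, Matrix.sub_mul, Matrix.sub_mul, Matrix.mul_one]
          simp only [Matrix.smul_mul, Matrix.mul_smul]
  rw [precision, Matrix.mul_sub, Matrix.add_mul, Matrix.add_mul, hDD, h1, Matrix.smul_mul,
    Matrix.smul_mul, h2, smul_sub, smul_smul, mul_inv_cancel₀ hβ.ne', one_smul]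
  abel

theorem precision_inv_apply_self (hβ : 0 < β) {γ : Fin n → ℝ} (hγ : ∀ i, 0 < γ i) (i : Fin n) :
    (precision F β γ)⁻¹ i i = γ i * (1 - γ i * columnForm F β γ i) := by
  rw [precision_inv hβ hγ, columnForm, Matrix.sub_apply, mul_diagonal, diagonal_apply_eq,
    show diagonal γ * Fᵀ * (marginalCov F β γ)⁻¹ * F =
      diagonal γ * (Fᵀ * (marginalCov F β γ)⁻¹ * F) by simp only [Matrix.mul_assoc],
    diagonal_mul]
  ring

theorem mul_columnForm_le_one (hβ : 0 < β) {γ : Fin n → ℝ} (hγ : ∀ i, 0 < γ i) (i : Fin n) :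
    γ i * columnForm F β γ i ≤ 1 := by
  have h : 0 ≤ (precision F β γ)⁻¹ i i := (posDef_precision hβ hγ).inv.posSemidef.diag_nonneg
  rw [precision_inv_apply_self hβ hγ] at h
  have := nonneg_of_mul_nonneg_right h (hγ i)
  linarith

theorem det_marginalCov_eq (hβ : 0 < β) {γ : Fin n → ℝ} (hγ : ∀ i, 0 < γ i) :
    (marginalCov F β γ).det = β⁻¹ ^ m * ((∏ i, γ i) * (precision F β γ).det) := by
  have h1 : marginalCov F β γ = β⁻¹ • (1 + F * (β • (diagonal γ * Fᵀ))) := by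
    rw [marginalCov, smul_add, Matrix.mul_smul, smul_smul, inv_mul_cancel₀ hβ.ne', one_smul,
      Matrix.mul_assoc]
  have h2 : diagonal γ * precision F β γ = 1 + (β • (diagonal γ * Fᵀ)) * F := by
    have : diagonal γ * diagonal (fun i => (γ i)⁻¹) = 1 := by
      rw [diagonal_mul_diagonal, ← diagonal_one]
      congr 1
      ext i
      exact mul_inv_cancel₀ (hγ i).ne'
    rw [precision, Matrix.mul_add, this, Matrix.mul_smul, Matrix.smul_mul, Matrix.mul_assoc]
  rw [h1, det_smul, det_one_add_mul_comm, ← h2, det_mul, det_diagonal, Fintype.card_fin]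

theorem logDetTerm_eq_log_det_precision (hβ : 0 < β) {γ : Fin n → ℝ} (hγ : ∀ i, 0 < γ i) :
    logDetTerm F β γ =
      Real.log (β⁻¹ ^ m) + (∑ i, Real.log (γ i) + Real.log (precision F β γ).det) := by
  have h1 : (∏ i, γ i) ≠ 0 := Finset.prod_ne_zero_iff.mpr fun i _ => (hγ i).ne'
  have h2 := (posDef_precision (F := F) hβ hγ).det_pos.ne'
  rw [logDetTerm, det_marginalCov_eq hβ hγ, Real.log_mul (pow_ne_zero _ (inv_ne_zero hβ.ne'))
    (mul_ne_zero h1 h2), Real.log_mul h1 h2, Real.log_prod fun i _ => (hγ i).ne']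

/-- The tangent-plane inequality of `log det` applied to the precision matrix, which is affine in
`1 / γ`. -/
theorem logDetTerm_le_add_sum_inv (hβ : 0 < β) {γ γ' : Fin n → ℝ} (hγ : ∀ i, 0 < γ i)
    (hγ' : ∀ i, 0 < γ' i) :
    logDetTerm F β γ' ≤ logDetTerm F β γ + ∑ i, (Real.log (γ' i) - Real.log (γ i) +
      γ i * (1 - γ i * columnForm F β γ i) * ((γ' i)⁻¹ - (γ i)⁻¹)) := by
  have h := (posDef_precision (F := F) hβ hγ').log_det_le_add_trace
    (posDef_precision (F := F) hβ hγ)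
  have hd : precision F β γ' - precision F β γ = diagonal (fun i => (γ' i)⁻¹ - (γ i)⁻¹) := by
    rw [precision, precision, add_sub_add_right_eq_sub, diagonal_sub]
  rw [hd] at h
  simp only [Matrix.trace, diag_apply, mul_diagonal, precision_inv_apply_self hβ hγ] at h
  rw [logDetTerm_eq_log_det_precision hβ hγ, logDetTerm_eq_log_det_precision hβ hγ',
    Finset.sum_add_distrib, Finset.sum_sub_distrib]
  linarith

end Precision

/-! ### A quadratic upper bound for `log det S(θ⁻²)` -/

section Scalar

theorem neg_two_mul_log_add_le {u : ℝ} (hu : 0 < u) :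
    -2 * Real.log u + 2 * (u - 1) ≤ (u - 1) ^ 2 * max 1 (u ^ 2)⁻¹ := by
  rcases le_total 1 u with h | h
  · have h1 := Real.le_log_one_add_of_nonneg (sub_nonneg.mpr h)
    rw [add_sub_cancel] at h1
    have h2 : (u - 1) - (u - 1) ^ 2 / 2 ≤ 2 * (u - 1) / (u - 1 + 2) := by
      rw [le_div_iff₀ (by linarith)]
      nlinarith [pow_nonneg (sub_nonneg.mpr h) 3]
    have h3 : (u - 1) ^ 2 * 1 ≤ (u - 1) ^ 2 * max 1 (u ^ 2)⁻¹ :=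
      mul_le_mul_of_nonneg_left (le_max_left _ _) (sq_nonneg _)
    linarith
  · have h1 : -Real.log u ≤ Real.sinh (-Real.log u) :=
      Real.self_le_sinh_iff.mpr (neg_nonneg.mpr (Real.log_nonpos hu.le h))
    rw [Real.sinh_eq, neg_neg, Real.exp_neg, Real.exp_log hu] at h1
    have h2 : u⁻¹ - u + 2 * (u - 1) ≤ (u - 1) ^ 2 * (u ^ 2)⁻¹ := by
      have : (u - 1) ^ 2 * (u ^ 2)⁻¹ - (u⁻¹ - u + 2 * (u - 1)) = (1 - u) ^ 3 * (u ^ 2)⁻¹ := by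
        field_simp
        ring
      have h3 : 0 ≤ (1 - u) ^ 3 * (u ^ 2)⁻¹ :=
        mul_nonneg (pow_nonneg (by linarith) 3) (by positivity)
      linarith
    have h3 : (u - 1) ^ 2 * (u ^ 2)⁻¹ ≤ (u - 1) ^ 2 * max 1 (u ^ 2)⁻¹ :=
      mul_le_mul_of_nonneg_left (le_max_right _ _) (sq_nonneg _)
    linarith

theorem inv_sq_sub_one_add_le {u : ℝ} (hu : 0 < u) :
    (u ^ 2)⁻¹ - 1 + 2 * (u - 1) ≤ 3 * (u - 1) ^ 2 * max 1 (u ^ 2)⁻¹ := by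
  have h0 : (u ^ 2)⁻¹ - 1 + 2 * (u - 1) = (u - 1) ^ 2 * ((1 + 2 * u) * (u ^ 2)⁻¹) := by
    field_simp
    ring
  have h1 : (1 + 2 * u) * (u ^ 2)⁻¹ ≤ 3 * max 1 (u ^ 2)⁻¹ := by
    rcases le_total 1 u with h | h
    · have : (1 + 2 * u) * (u ^ 2)⁻¹ ≤ 3 := by
        rw [← div_eq_mul_inv, div_le_iff₀ (by positivity)]
        nlinarith
      linarith [le_max_left 1 (u ^ 2)⁻¹]
    · have h2 : (1 + 2 * u) * (u ^ 2)⁻¹ ≤ 3 * (u ^ 2)⁻¹ :=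
        mul_le_mul_of_nonneg_right (by linarith) (by positivity)
      linarith [le_max_right 1 (u ^ 2)⁻¹]
  rw [h0]
  linarith [mul_le_mul_of_nonneg_left h1 (sq_nonneg (u - 1))]

/-- The weights `3/4` and `1/4` balance the two curvature bounds `M + 1 - p` and `3 p M`, so that
the mean is at most `3 M / 2` for every `p ∈ [0, 1]`. -/
theorem averaged_tangent_le {u p : ℝ} (hu : 0 < u) (hp0 : 0 ≤ p) (hp1 : p ≤ 1) :
    3 / 4 * (-2 * Real.log u + (1 - p) * (u ^ 2 - 1)) + 1 / 4 * (p * ((u ^ 2)⁻¹ - 1)) ≤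
      -2 * p * (u - 1) + 3 / 2 * ((u - 1) ^ 2 * max 1 (u ^ 2)⁻¹) := by
  have h1 := neg_two_mul_log_add_le hu
  have h2 := mul_le_mul_of_nonneg_left (inv_sq_sub_one_add_le hu) hp0
  set M := max 1 (u ^ 2)⁻¹
  have hM : 0 ≤ (1 - p) * ((u - 1) ^ 2 * (M - 1)) :=
    mul_nonneg (by linarith) (mul_nonneg (sq_nonneg _) (by linarith [le_max_left 1 (u ^ 2)⁻¹]))
  linarith

end Scalar

section Theta

variable {m n : ℕ} {F : Matrix (Fin m) (Fin n) ℝ} {β : ℝ}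

theorem invSq_pos {θ : Fin n → ℝ} (hθ : θ ∈ posOrthant n) (i : Fin n) : 0 < invSq θ i :=
  inv_pos.mpr (pow_pos (hθ i) 2)

theorem averaged_tangent_coord_le {θ θ' h C : ℝ} (hθ : 0 < θ) (hθ' : 0 < θ') (hh : 0 ≤ h)
    (hh1 : (θ ^ 2)⁻¹ * h ≤ 1) (hC : (θ ^ 2)⁻¹ ≤ C) (hC' : (θ' ^ 2)⁻¹ ≤ C) :
    3 / 4 * (Real.log (θ' ^ 2)⁻¹ - Real.log (θ ^ 2)⁻¹ + (θ ^ 2)⁻¹ * (1 - (θ ^ 2)⁻¹ * h) *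
        (((θ' ^ 2)⁻¹)⁻¹ - ((θ ^ 2)⁻¹)⁻¹)) + 1 / 4 * (h * ((θ' ^ 2)⁻¹ - (θ ^ 2)⁻¹)) ≤
      -(2 * (θ ^ 2)⁻¹ * h / θ) * (θ' - θ) + 3 / 2 * (C * (θ' - θ) ^ 2) := by
  have key := averaged_tangent_le (div_pos hθ' hθ) (mul_nonneg (by positivity) hh) hh1
  have e1 : Real.log (θ' ^ 2)⁻¹ - Real.log (θ ^ 2)⁻¹ = -2 * Real.log (θ' / θ) := by
    rw [Real.log_inv, Real.log_inv, Real.log_pow, Real.log_pow, Real.log_div hθ'.ne' hθ.ne']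
    push_cast
    ring
  have e2 : (θ ^ 2)⁻¹ * (1 - (θ ^ 2)⁻¹ * h) * (((θ' ^ 2)⁻¹)⁻¹ - ((θ ^ 2)⁻¹)⁻¹) =
      (1 - (θ ^ 2)⁻¹ * h) * ((θ' / θ) ^ 2 - 1) := by
    field_simp
  have e3 : h * ((θ' ^ 2)⁻¹ - (θ ^ 2)⁻¹) = (θ ^ 2)⁻¹ * h * (((θ' / θ) ^ 2)⁻¹ - 1) := by
    field_simp
  have e4 : -(2 * (θ ^ 2)⁻¹ * h / θ) * (θ' - θ) = -2 * ((θ ^ 2)⁻¹ * h) * (θ' / θ - 1) := by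
    field_simp
  have e5 : (θ' / θ - 1) ^ 2 * max 1 ((θ' / θ) ^ 2)⁻¹ ≤ C * (θ' - θ) ^ 2 := by
    have h1 : (θ' / θ - 1) ^ 2 = (θ' - θ) ^ 2 * (θ ^ 2)⁻¹ := by field_simp
    rw [h1, mul_assoc, mul_comm C]
    refine mul_le_mul_of_nonneg_left ?_ (sq_nonneg _)
    rw [mul_max_of_nonneg _ _ (by positivity)]
    refine max_le (by simpa using hC) (le_of_eq_of_le ?_ hC')
    field_simp
  rw [e1, e2, e3, e4]
  linarith

/-- A quadratic upper bound for `Ψ(θ) = log det S(θ⁻²)`, whose linear part turns out to be the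
derivative of `Ψ`. It is a weighted mean of the tangent-plane inequalities of the concave functions
`γ ↦ log det S(γ)` and `ω ↦ log det S(1 / ω) + ∑ᵢ log ωᵢ`. -/
theorem logDetTheta_le_quadratic (hβ : 0 < β) {θ θ' C : Fin n → ℝ} (hθ : θ ∈ posOrthant n)
    (hθ' : θ' ∈ posOrthant n) (hC : ∀ i, invSq θ i ≤ C i) (hC' : ∀ i, invSq θ' i ≤ C i) :
    logDetTheta F β θ' ≤ logDetTheta F β θ +
      ∑ i, (-(2 * invSq θ i * columnForm F β (invSq θ) i / θ i) * (θ' i - θ i) +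
        3 / 2 * (C i * (θ' i - θ i) ^ 2)) := by
  have h1 := logDetTerm_le_add_sum_inv (F := F) hβ (invSq_pos hθ) (invSq_pos hθ')
  have h2 := logDetTerm_le_add_sum (F := F) hβ (fun i => (invSq_pos hθ i).le)
    (fun i => (invSq_pos hθ' i).le)
  have h3 := Finset.sum_le_sum fun i (_ : i ∈ Finset.univ) =>
    averaged_tangent_coord_le (hθ i) (hθ' i)
      (columnForm_nonneg (F := F) hβ (fun i => (invSq_pos hθ i).le) i)
      (mul_columnForm_le_one (F := F) hβ (invSq_pos hθ) i) (hC i) (hC' i)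
  rw [Finset.sum_add_distrib, ← Finset.mul_sum, ← Finset.mul_sum] at h3
  simp only [logDetTheta]
  simp only [invSq] at h1 h2 h3 ⊢
  linarith

end Theta

/-! ### Differentiability -/

section Differentiability

theorem DifferentiableAt.matrix_det {E ι : Type*} [NormedAddCommGroup E] [NormedSpace ℝ E]
    [Fintype ι] [DecidableEq ι] {M : E → Matrix ι ι ℝ} {x : E}
    (hM : ∀ a b, DifferentiableAt ℝ (fun e => M e a b) x) :
    DifferentiableAt ℝ (fun e => (M e).det) x := by
  simp only [det_apply']
  refine DifferentiableAt.fun_sum fun σ _ => DifferentiableAt.const_mul ?_ _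
  exact (HasFDerivAt.finsetProd fun i _ => (hM (σ i) i).hasFDerivAt).differentiableAt

theorem DifferentiableAt.matrix_inv_apply {E ι : Type*} [NormedAddCommGroup E] [NormedSpace ℝ E]
    [Fintype ι] [DecidableEq ι] {M : E → Matrix ι ι ℝ} {x : E}
    (hM : ∀ a b, DifferentiableAt ℝ (fun e => M e a b) x) (hdet : (M x).det ≠ 0) (a b : ι) :
    DifferentiableAt ℝ (fun e => (M e)⁻¹ a b) x := by
  simp only [inv_def, Ring.inverse_eq_inv', Matrix.smul_apply, smul_eq_mul, adjugate_apply]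
  refine ((DifferentiableAt.matrix_det hM).inv hdet).mul (DifferentiableAt.matrix_det fun c d => ?_)
  by_cases h : c = b
  · simp [h]
  · simpa [updateRow_apply, h] using hM c d

variable {m n : ℕ} {F : Matrix (Fin m) (Fin n) ℝ} {β : ℝ}

theorem differentiable_marginalCov_apply (a b : Fin m) :
    Differentiable ℝ (fun γ : Fin n → ℝ => marginalCov F β γ a b) := by
  have h : (fun γ : Fin n → ℝ => marginalCov F β γ a b) =
      fun γ => (β⁻¹ • (1 : Matrix (Fin m) (Fin m) ℝ)) a b + ∑ k, F a k * γ k * F b k := by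
    ext γ
    rw [marginalCov, Matrix.add_apply, Matrix.mul_apply]
    simp only [Matrix.mul_diagonal, transpose_apply]
  rw [h]
  fun_prop

theorem differentiableAt_logDetTerm (hβ : 0 < β) {γ : Fin n → ℝ} (hγ : ∀ i, 0 ≤ γ i) :
    DifferentiableAt ℝ (logDetTerm F β) γ :=
  (DifferentiableAt.matrix_det fun a b =>
    (differentiable_marginalCov_apply a b).differentiableAt).log
    (posDef_marginalCov hβ hγ).det_pos.ne'

theorem differentiableAt_marginalCov_inv (hβ : 0 < β) {γ : Fin n → ℝ} (hγ : ∀ i, 0 ≤ γ i)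
    (a b : Fin m) : DifferentiableAt ℝ (fun γ => (marginalCov F β γ)⁻¹ a b) γ :=
  DifferentiableAt.matrix_inv_apply
    (fun a b => (differentiable_marginalCov_apply a b).differentiableAt)
    (posDef_marginalCov hβ hγ).det_pos.ne' a b

theorem differentiableAt_marginalCov_inv_mulVec (hβ : 0 < β) {γ : Fin n → ℝ} (hγ : ∀ i, 0 ≤ γ i)
    (y : Fin m → ℝ) (a : Fin m) :
    DifferentiableAt ℝ (fun γ => ((marginalCov F β γ)⁻¹ *ᵥ y) a) γ := by
  simp only [mulVec, dotProduct]
  exact DifferentiableAt.fun_sum fun b _ =>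
    (differentiableAt_marginalCov_inv hβ hγ a b).mul_const _

theorem continuousAt_columnForm (hβ : 0 < β) {γ : Fin n → ℝ} (hγ : ∀ i, 0 ≤ γ i) (i : Fin n) :
    ContinuousAt (fun γ => columnForm F β γ i) γ := by
  refine DifferentiableAt.continuousAt (𝕜 := ℝ) ?_
  simp only [columnForm, Matrix.mul_apply]
  exact DifferentiableAt.fun_sum fun b _ => (DifferentiableAt.fun_sum fun a _ =>
    (differentiableAt_marginalCov_inv hβ hγ a b).const_mul _).mul_const _

/-- The gradient of `Ψ` is read off from the fact that `Ψ - ∑ᵢ hᵢ(θ⁻²) θ'ᵢ⁻²` has a maximum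
at `θ' = θ`. -/
theorem fderiv_logDetTheta (hβ : 0 < β) {θ : Fin n → ℝ} (hθ : θ ∈ posOrthant n) (v : Fin n → ℝ) :
    fderiv ℝ (logDetTheta F β) θ v =
      ∑ i, -(2 * invSq θ i * columnForm F β (invSq θ) i / θ i) * v i := by
  set h := columnForm F β (invSq θ)
  have hinv : ∀ i, HasFDerivAt (fun θ' : Fin n → ℝ => h i * invSq θ' i)
      ((h i * -(2 * invSq θ i / θ i)) •
        ContinuousLinearMap.proj (R := ℝ) (φ := fun _ => ℝ) i) θ := by
    intro i
    have h1 : HasDerivAt (fun t : ℝ => h i * (t ^ 2)⁻¹) (h i * -(2 * invSq θ i / θ i)) (θ i) := by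
      have h2 := ((hasDerivAt_pow 2 (θ i)).fun_inv (pow_pos (hθ i) 2).ne').const_mul (h i)
      refine h2.congr_deriv ?_
      have := (hθ i).ne'
      simp only [invSq]
      field_simp
      norm_num
      ring
    exact h1.comp_hasFDerivAt (f := fun θ' : Fin n → ℝ => θ' i) θ (hasFDerivAt_apply i θ)
  have hsum := HasFDerivAt.fun_sum fun i (_ : i ∈ Finset.univ) => hinv i
  have hdiff : DifferentiableAt ℝ (logDetTheta F β) θ := by
    refine DifferentiableAt.comp θ (differentiableAt_logDetTerm hβ fun i => (invSq_pos hθ i).le) ?_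
    refine differentiableAt_pi.mpr fun i => ?_
    exact ((differentiableAt_apply i θ).pow 2).inv (pow_pos (hθ i) 2).ne'
  have hmax : IsLocalMax (fun θ' => logDetTheta F β θ' - ∑ i, h i * invSq θ' i) θ := by
    have hopen : ∀ᶠ θ' in 𝓝 θ, ∀ i, 0 < θ' i :=
      eventually_all.mpr fun i => (continuous_apply i).continuousAt.eventually (lt_mem_nhds (hθ i))
    filter_upwards [hopen] with θ' hθ'
    have := logDetTerm_le_add_sum (F := F) hβ (fun i => (invSq_pos hθ i).le)
      (fun i => (invSq_pos hθ' i).le)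
    simp only [mul_sub, Finset.sum_sub_distrib] at this
    simp only [logDetTheta]
    linarith
  have hzero := hmax.hasFDerivAt_eq_zero (hdiff.hasFDerivAt.sub hsum)
  rw [sub_eq_zero.mp hzero, _root_.sum_apply]
  refine Finset.sum_congr rfl fun i _ => ?_
  simp only [_root_.smul_apply, ContinuousLinearMap.proj_apply, smul_eq_mul]
  ring

end Differentiability

/-! ### The inner minimizations -/

section Inner

variable {m n : ℕ} {F : Matrix (Fin m) (Fin n) ℝ} {y : Fin m → ℝ} {β τ : ℝ}

/-- The vector `Fᵀ S(γ)⁻¹ y`. -/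
noncomputable def backProjection (F : Matrix (Fin m) (Fin n) ℝ) (y : Fin m → ℝ) (β : ℝ)
    (γ : Fin n → ℝ) : Fin n → ℝ :=
  Fᵀ *ᵥ ((marginalCov F β γ)⁻¹ *ᵥ y)

/-- The minimizer `diag(γ) Fᵀ S(γ)⁻¹ y` of `auxObjective F y β · γ`. -/
noncomputable def posteriorMean (F : Matrix (Fin m) (Fin n) ℝ) (y : Fin m → ℝ) (β : ℝ)
    (γ : Fin n → ℝ) : Fin n → ℝ :=
  fun i => γ i * backProjection F y β γ i

/-- The identity `y = S(γ) w` for `w = S(γ)⁻¹ y`. -/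
theorem eq_smul_add_mulVec_posteriorMean (hβ : 0 < β) {γ : Fin n → ℝ} (hγ : ∀ i, 0 ≤ γ i) :
    y = β⁻¹ • ((marginalCov F β γ)⁻¹ *ᵥ y) + F *ᵥ posteriorMean F y β γ := by
  set w := (marginalCov F β γ)⁻¹ *ᵥ y with hw
  have hSw : marginalCov F β γ *ᵥ w = y := by
    rw [hw, mulVec_mulVec, mul_nonsing_inv _ (isUnit_det_marginalCov hβ hγ), one_mulVec]
  conv_lhs => rw [← hSw]
  rw [marginalCov, add_mulVec, smul_mulVec, one_mulVec, ← mulVec_mulVec, ← mulVec_mulVec]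
  congr 2
  ext i
  rw [mulVec_diagonal]
  rfl

/-- Completing the square in the auxiliary variable. -/
theorem auxObjective_eq (hβ : 0 < β) {γ : Fin n → ℝ} (hγ : ∀ i, 0 < γ i) (z : Fin n → ℝ) :
    auxObjective F y β z γ = y ⬝ᵥ ((marginalCov F β γ)⁻¹ *ᵥ y) +
      (β * ∑ j, ((F *ᵥ z) j - y j + β⁻¹ * ((marginalCov F β γ)⁻¹ *ᵥ y) j) ^ 2 +
        ∑ i, (z i - posteriorMean F y β γ i) ^ 2 / γ i) := by
  set w := (marginalCov F β γ)⁻¹ *ᵥ y with hw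
  have hadj : ∀ v : Fin n → ℝ, ∑ j, w j * (F *ᵥ v) j = ∑ i, v i * (Fᵀ *ᵥ w) i := fun v => by
    change w ⬝ᵥ (F *ᵥ v) = v ⬝ᵥ (Fᵀ *ᵥ w)
    rw [dotProduct_mulVec, mulVec_transpose, dotProduct_comm]
  have hyw : ∑ j, y j * w j = β⁻¹ * ∑ j, w j ^ 2 + ∑ i, γ i * (Fᵀ *ᵥ w) i ^ 2 := by
    have h1 : y = β⁻¹ • w + F *ᵥ (fun i => γ i * (Fᵀ *ᵥ w) i) :=
      eq_smul_add_mulVec_posteriorMean hβ fun i => (hγ i).le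
    have h2 := hadj (fun i => γ i * (Fᵀ *ᵥ w) i)
    have h3 : ∀ j, y j * w j =
        β⁻¹ * w j ^ 2 + w j * (F *ᵥ (fun i => γ i * (Fᵀ *ᵥ w) i)) j := fun j => by
      conv_lhs => rw [h1]
      simp only [Pi.add_apply, Pi.smul_apply, smul_eq_mul]
      ring
    rw [Finset.sum_congr rfl fun j _ => h3 j, Finset.sum_add_distrib, ← Finset.mul_sum, h2]
    congr 1
    exact Finset.sum_congr rfl fun i _ => by ring
  have e1 : β * ∑ j, ((F *ᵥ z) j - y j + β⁻¹ * w j) ^ 2 =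
      β * ∑ j, ((F *ᵥ z) j - y j) ^ 2 + 2 * ∑ i, z i * (Fᵀ *ᵥ w) i - 2 * ∑ j, y j * w j +
        β⁻¹ * ∑ j, w j ^ 2 := by
    rw [← hadj z]
    simp only [Finset.mul_sum, ← Finset.sum_add_distrib, ← Finset.sum_sub_distrib]
    refine Finset.sum_congr rfl fun j _ => ?_
    field_simp
    ring
  have e2 : ∑ i, (z i - posteriorMean F y β γ i) ^ 2 / γ i =
      ∑ i, z i ^ 2 / γ i - 2 * ∑ i, z i * (Fᵀ *ᵥ w) i + ∑ i, γ i * (Fᵀ *ᵥ w) i ^ 2 := by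
    simp only [Finset.mul_sum, ← Finset.sum_add_distrib, ← Finset.sum_sub_distrib]
    refine Finset.sum_congr rfl fun i _ => ?_
    have := (hγ i).ne'
    simp only [posteriorMean, backProjection, ← hw]
    field_simp
    ring
  rw [e1, e2, auxObjective]
  change _ = ∑ j, y j * w j + _
  linarith

theorem le_auxObjective (hβ : 0 < β) {γ : Fin n → ℝ} (hγ : ∀ i, 0 < γ i) (z : Fin n → ℝ) :
    y ⬝ᵥ ((marginalCov F β γ)⁻¹ *ᵥ y) ≤ auxObjective F y β z γ := by
  rw [auxObjective_eq hβ hγ]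
  have h1 := Finset.sum_nonneg fun i (_ : i ∈ Finset.univ) =>
    div_nonneg (sq_nonneg (z i - posteriorMean F y β γ i)) (hγ i).le
  exact le_add_of_nonneg_right (add_nonneg
    (mul_nonneg hβ.le (Finset.sum_nonneg fun j _ => sq_nonneg _)) h1)

theorem auxObjective_posteriorMean (hβ : 0 < β) {γ : Fin n → ℝ} (hγ : ∀ i, 0 < γ i) :
    auxObjective F y β (posteriorMean F y β γ) γ = y ⬝ᵥ ((marginalCov F β γ)⁻¹ *ᵥ y) := by
  rw [auxObjective_eq hβ hγ]
  set w := (marginalCov F β γ)⁻¹ *ᵥ y with hw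
  have h1 : y = β⁻¹ • w + F *ᵥ posteriorMean F y β γ :=
    eq_smul_add_mulVec_posteriorMean hβ fun i => (hγ i).le
  have h2 : ∀ j, (F *ᵥ posteriorMean F y β γ) j - y j + β⁻¹ * w j = 0 := fun j => by
    have := congrFun h1 j
    simp only [Pi.add_apply, Pi.smul_apply, smul_eq_mul] at this
    linarith
  simp [h2]

theorem isMinOn_posteriorMean (hβ : 0 < β) {γ : Fin n → ℝ} (hγ : ∀ i, 0 < γ i) :
    IsMinOn (fun z => auxObjective F y β z γ) Set.univ (posteriorMean F y β γ) := by
  simpa only [isMinOn_iff, auxObjective_posteriorMean hβ hγ] using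
    fun z _ => le_auxObjective hβ hγ z

theorem eq_posteriorMean (hβ : 0 < β) {γ z : Fin n → ℝ} (hγ : ∀ i, 0 < γ i)
    (hz : IsMinOn (fun z => auxObjective F y β z γ) Set.univ z) : z = posteriorMean F y β γ := by
  have h := isMinOn_iff.mp hz _ (Set.mem_univ (posteriorMean F y β γ))
  rw [auxObjective_posteriorMean hβ hγ, auxObjective_eq hβ hγ] at h
  have h1 : ∀ i ∈ Finset.univ, 0 ≤ (z i - posteriorMean F y β γ i) ^ 2 / γ i := fun i _ =>
    div_nonneg (sq_nonneg _) (hγ i).le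
  have h2 : 0 ≤ β * ∑ j, ((F *ᵥ z) j - y j + β⁻¹ * ((marginalCov F β γ)⁻¹ *ᵥ y) j) ^ 2 :=
    mul_nonneg hβ.le (Finset.sum_nonneg fun j _ => sq_nonneg _)
  have h3 : ∑ i, (z i - posteriorMean F y β γ i) ^ 2 / γ i = 0 :=
    le_antisymm (by linarith) (Finset.sum_nonneg h1)
  ext i
  have h4 := (Finset.sum_eq_zero_iff_of_nonneg h1).mp h3 i (Finset.mem_univ i)
  rw [div_eq_zero_iff, or_iff_left (hγ i).ne', sq_eq_zero_iff, sub_eq_zero] at h4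
  exact h4

/-- The negative `2 γᵢ hᵢ(γ) / θᵢ` of the `i`-th partial derivative of `Ψ` at `θ`. -/
noncomputable def negGrad (F : Matrix (Fin m) (Fin n) ℝ) (β : ℝ) (θ : Fin n → ℝ) (i : Fin n) : ℝ :=
  2 * invSq θ i * columnForm F β (invSq θ) i / θ i

theorem negGrad_nonneg (hβ : 0 < β) {θ : Fin n → ℝ} (hθ : θ ∈ posOrthant n) (i : Fin n) :
    0 ≤ negGrad F β θ i :=
  div_nonneg (mul_nonneg (mul_nonneg zero_le_two (invSq_pos hθ i).le)
    (columnForm_nonneg hβ (fun i => (invSq_pos hθ i).le) i)) (hθ i).le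

/-- The minimizer of the separable quadratic that defines `θ^(k+1/2)` from `θ^(k) = θ` and
`x^(k) = x`. -/
noncomputable def proxPoint (F : Matrix (Fin m) (Fin n) ℝ) (β τ : ℝ) (x θ : Fin n → ℝ) :
    Fin n → ℝ :=
  fun i => (τ * θ i + negGrad F β θ i) / (2 * x i ^ 2 + τ)

theorem proxPoint_mem (hβ : 0 < β) (hτ : 0 < τ) (x : Fin n → ℝ) {θ : Fin n → ℝ}
    (hθ : θ ∈ posOrthant n) : proxPoint F β τ x θ ∈ posOrthant n := fun i =>
  div_pos (add_pos_of_pos_of_nonneg (mul_pos hτ (hθ i)) (negGrad_nonneg hβ hθ i)) (by positivity)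

/-- The stationarity condition that characterizes `proxPoint`. -/
theorem proxPoint_stationary (hτ : 0 < τ) (x θ : Fin n → ℝ) (i : Fin n) :
    2 * x i ^ 2 * proxPoint F β τ x θ i + τ * (proxPoint F β τ x θ i - θ i) = negGrad F β θ i := by
  have : proxPoint F β τ x θ i * (2 * x i ^ 2 + τ) = τ * θ i + negGrad F β θ i :=
    div_mul_cancel₀ _ (by positivity)
  linarith

/-- Completing the square in the surrogate objective. -/
theorem surrogate_eq (hβ : 0 < β) (hτ : 0 < τ) (x : Fin n → ℝ) {θ : Fin n → ℝ}
    (hθ : θ ∈ posOrthant n) (ϑ : Fin n → ℝ) :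
    auxObjective F y β x (invSq ϑ) + proxSurrogate F β τ θ ϑ =
      auxObjective F y β x (invSq (proxPoint F β τ x θ)) +
        proxSurrogate F β τ θ (proxPoint F β τ x θ) +
        ∑ i, (x i ^ 2 + τ / 2) * (ϑ i - proxPoint F β τ x θ i) ^ 2 := by
  have hsum : ∀ ϑ : Fin n → ℝ, auxObjective F y β x (invSq ϑ) + proxSurrogate F β τ θ ϑ =
      β * ∑ j, ((F *ᵥ x) j - y j) ^ 2 + logDetTheta F β θ +
        ∑ i, (x i ^ 2 * ϑ i ^ 2 - negGrad F β θ i * (ϑ i - θ i) + τ / 2 * (ϑ i - θ i) ^ 2) := by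
    intro ϑ
    simp only [auxObjective, proxSurrogate, fderiv_logDetTheta hβ hθ, invSq, div_inv_eq_mul,
      Finset.sum_add_distrib, Finset.sum_sub_distrib, ← Finset.mul_sum, negGrad, Pi.sub_apply,
      neg_mul, Finset.sum_neg_distrib]
    ring
  rw [hsum, hsum, add_assoc _ (∑ i, _) (∑ i, _), ← Finset.sum_add_distrib]
  congr 1
  refine Finset.sum_congr rfl fun i _ => ?_
  rw [← proxPoint_stationary (F := F) (β := β) hτ x θ i]
  ring

theorem isMinOn_proxPoint (hβ : 0 < β) (hτ : 0 < τ) (x : Fin n → ℝ) {θ : Fin n → ℝ}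
    (hθ : θ ∈ posOrthant n) :
    IsMinOn (fun ϑ => auxObjective F y β x (invSq ϑ) + proxSurrogate F β τ θ ϑ) (posOrthant n)
      (proxPoint F β τ x θ) := isMinOn_iff.mpr fun ϑ _ => by
  rw [surrogate_eq hβ hτ x hθ ϑ]
  exact le_add_of_nonneg_right (Finset.sum_nonneg fun i _ => by positivity)

theorem eq_proxPoint (hβ : 0 < β) (hτ : 0 < τ) (x : Fin n → ℝ) {θ ϑ : Fin n → ℝ}
    (hθ : θ ∈ posOrthant n)
    (hϑ : IsMinOn (fun ϑ => auxObjective F y β x (invSq ϑ) + proxSurrogate F β τ θ ϑ)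
      (posOrthant n) ϑ) : ϑ = proxPoint F β τ x θ := by
  have h := isMinOn_iff.mp hϑ _ (proxPoint_mem (F := F) hβ hτ x hθ)
  rw [surrogate_eq hβ hτ x hθ ϑ] at h
  have h1 : ∀ i ∈ Finset.univ, 0 ≤ (x i ^ 2 + τ / 2) * (ϑ i - proxPoint F β τ x θ i) ^ 2 :=
    fun i _ => by positivity
  have h2 := (Finset.sum_eq_zero_iff_of_nonneg h1).mp
    (le_antisymm (by linarith) (Finset.sum_nonneg h1))
  ext i
  have h3 := h2 i (Finset.mem_univ i)
  rw [mul_eq_zero, or_iff_right (by positivity), sq_eq_zero_iff, sub_eq_zero] at h3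
  exact h3

/-- The direction `θ^(k+1/2) - θ^(k)` determined by `θ^(k) = θ`. -/
noncomputable def amqDir (F : Matrix (Fin m) (Fin n) ℝ) (y : Fin m → ℝ) (β τ : ℝ)
    (θ : Fin n → ℝ) : Fin n → ℝ :=
  proxPoint F β τ (posteriorMean F y β (invSq θ)) θ - θ

/-- The descent estimate for one step of length `s`. -/
theorem evidenceObjective_step_le (hβ : 0 < β) (hτ : 0 < τ) {θ C : Fin n → ℝ} {s : ℝ}
    (hθ : θ ∈ posOrthant n) (hθ' : θ + s • amqDir F y β τ θ ∈ posOrthant n)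
    (hC : ∀ i, invSq θ i ≤ C i) (hC' : ∀ i, invSq (θ + s • amqDir F y β τ θ) i ≤ C i) :
    evidenceObjective F y β (invSq (θ + s • amqDir F y β τ θ)) ≤ evidenceObjective F y β (invSq θ) +
      ∑ i, (s ^ 2 * (posteriorMean F y β (invSq θ) i ^ 2 + 3 / 2 * C i) -
        s * (2 * posteriorMean F y β (invSq θ) i ^ 2 + τ)) * amqDir F y β τ θ i ^ 2 := by
  set x := posteriorMean F y β (invSq θ) with hx
  set d := amqDir F y β τ θ with hd
  have h1 := le_auxObjective (F := F) (y := y) hβ (invSq_pos hθ') x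
  have h2 := auxObjective_posteriorMean (F := F) (y := y) hβ (invSq_pos hθ)
  have h3 := logDetTheta_le_quadratic (F := F) hβ hθ hθ' hC hC'
  have h4 : ∑ i, (s ^ 2 * (x i ^ 2 + 3 / 2 * C i) - s * (2 * x i ^ 2 + τ)) * d i ^ 2 =
      ∑ i, x i ^ 2 / invSq (θ + s • d) i - ∑ i, x i ^ 2 / invSq θ i +
      ∑ i, (-(2 * invSq θ i * columnForm F β (invSq θ) i / θ i) * ((θ + s • d) i - θ i) +
        3 / 2 * (C i * ((θ + s • d) i - θ i) ^ 2)) := by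
    rw [← Finset.sum_sub_distrib, ← Finset.sum_add_distrib]
    refine Finset.sum_congr rfl fun i _ => ?_
    have h5 := proxPoint_stationary (F := F) (β := β) hτ x θ i
    rw [negGrad] at h5
    have h6 : proxPoint F β τ x θ i = θ i + d i := by rw [hd, amqDir, ← hx]; simp
    rw [← h5, h6]
    simp only [invSq, div_inv_eq_mul, Pi.add_apply, Pi.smul_apply, smul_eq_mul]
    ring
  rw [h4]
  simp only [evidenceObjective]
  rw [← h2]
  simp only [logDetTheta] at h3
  simp only [auxObjective, ← hx] at h1 ⊢
  linarith

end Inner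

/-! ### Derivative and growth of the objective -/

section Objective

variable {m n : ℕ} {F : Matrix (Fin m) (Fin n) ℝ} {y : Fin m → ℝ} {β : ℝ}

theorem dotProduct_marginalCov_inv_nonneg (hβ : 0 < β) {γ : Fin n → ℝ} (hγ : ∀ i, 0 ≤ γ i) :
    0 ≤ y ⬝ᵥ ((marginalCov F β γ)⁻¹ *ᵥ y) := by
  simpa using (posDef_marginalCov (F := F) hβ hγ).inv.posSemidef.dotProduct_mulVec_nonneg y

theorem logDetTerm_le_evidenceObjective (hβ : 0 < β) {γ : Fin n → ℝ} (hγ : ∀ i, 0 ≤ γ i) :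
    logDetTerm F β γ ≤ evidenceObjective F y β γ :=
  le_add_of_nonneg_left (dotProduct_marginalCov_inv_nonneg hβ hγ)

theorem logDetTerm_zero_le_evidenceObjective (hβ : 0 < β) {γ : Fin n → ℝ} (hγ : ∀ i, 0 ≤ γ i) :
    logDetTerm F β 0 ≤ evidenceObjective F y β γ :=
  (logDetTerm_mono hβ (fun _ => le_rfl) hγ).trans (logDetTerm_le_evidenceObjective hβ hγ)

/-- Coercivity of the objective in every coordinate whose column of `F` does not vanish. -/
theorem le_of_evidenceObjective_le (hβ : 0 < β) {γ : Fin n → ℝ} (hγ : ∀ i, 0 ≤ γ i) {c : ℝ}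
    (hc : evidenceObjective F y β γ ≤ c) {i : Fin n} (hi : 0 < ∑ j, F j i ^ 2) :
    γ i ≤ Real.exp c / (β⁻¹ ^ m * β * ∑ j, F j i ^ 2) := by
  -- Keeping only the `i`-th entry of `γ` decreases `log det S`.
  have hs : ∀ k, 0 ≤ (Pi.single i (γ i) : Fin n → ℝ) k := fun k => by
    by_cases h : k = i
    · subst h; simpa using hγ k
    · simp [h]
  have hs' : ∀ k, (Pi.single i (γ i) : Fin n → ℝ) k ≤ γ k := fun k => by
    by_cases h : k = i
    · subst h; simp
    · simpa [h] using hγ k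
  have h1 : logDetTerm F β (Pi.single i (γ i)) ≤ c :=
    (logDetTerm_mono hβ hs hs').trans ((logDetTerm_le_evidenceObjective hβ hγ).trans hc)
  have h2 := (Real.log_le_iff_le_exp (posDef_marginalCov (F := F) hβ hs).det_pos).mp h1
  rw [det_marginalCov_single hβ.ne'] at h2
  have h3 : 0 < β⁻¹ ^ m := pow_pos (inv_pos.mpr hβ) m
  rw [le_div_iff₀ (mul_pos (mul_pos h3 hβ) hi)]
  linarith

/-- The tangent-plane inequality for the convex function `γ ↦ yᵀ S(γ)⁻¹ y`. -/
theorem dotProduct_marginalCov_inv_ge (hβ : 0 < β) {γ γ' : Fin n → ℝ} (hγ : ∀ i, 0 ≤ γ i)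
    (hγ' : ∀ i, 0 ≤ γ' i) :
    y ⬝ᵥ ((marginalCov F β γ)⁻¹ *ᵥ y) - ∑ i, backProjection F y β γ i ^ 2 * (γ' i - γ i) ≤
      y ⬝ᵥ ((marginalCov F β γ')⁻¹ *ᵥ y) := by
  set w := (marginalCov F β γ)⁻¹ *ᵥ y with hw
  set u := (marginalCov F β γ')⁻¹ *ᵥ y with hu
  have hSw : marginalCov F β γ *ᵥ w = y := by
    rw [hw, mulVec_mulVec, mul_nonsing_inv _ (isUnit_det_marginalCov hβ hγ), one_mulVec]
  have hSu : marginalCov F β γ' *ᵥ u = y := by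
    rw [hu, mulVec_mulVec, mul_nonsing_inv _ (isUnit_det_marginalCov hβ hγ'), one_mulVec]
  have hsymm : (marginalCov F β γ')ᵀ = marginalCov F β γ' := by
    simpa using (posDef_marginalCov (F := F) hβ hγ').isHermitian.eq
  have h1 : 0 ≤ (u - w) ⬝ᵥ (marginalCov F β γ' *ᵥ (u - w)) := by
    simpa using (posDef_marginalCov (F := F) hβ hγ').posSemidef.dotProduct_mulVec_nonneg (u - w)
  have h2 : u ⬝ᵥ (marginalCov F β γ' *ᵥ w) = w ⬝ᵥ y := by
    rw [dotProduct_mulVec, ← mulVec_transpose, hsymm, hSu, dotProduct_comm]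
  have h3 : w ⬝ᵥ (marginalCov F β γ' *ᵥ w) =
      w ⬝ᵥ y + ∑ i, backProjection F y β γ i ^ 2 * (γ' i - γ i) := by
    rw [← sub_add_cancel (marginalCov F β γ') (marginalCov F β γ), marginalCov_sub, add_mulVec,
      dotProduct_add, hSw, add_comm]
    congr 1
    rw [← mulVec_mulVec, ← mulVec_mulVec, dotProduct_mulVec, ← mulVec_transpose]
    simp only [dotProduct, mulVec_diagonal, Pi.sub_apply]
    refine Finset.sum_congr rfl fun i _ => ?_
    simp only [backProjection, ← hw]
    ring
  rw [mulVec_sub, sub_dotProduct, dotProduct_sub, dotProduct_sub, hSu, h2, h3] at h1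
  rw [dotProduct_comm y w, dotProduct_comm y u]
  linarith

theorem continuousAt_backProjection (hβ : 0 < β) {γ : Fin n → ℝ} (hγ : ∀ i, 0 ≤ γ i) (i : Fin n) :
    ContinuousAt (fun γ => backProjection F y β γ i) γ := by
  refine DifferentiableAt.continuousAt (𝕜 := ℝ) ?_
  change DifferentiableAt ℝ
    (fun γ => ∑ j, Fᵀ i j * ((marginalCov F β γ)⁻¹ *ᵥ y) j) γ
  exact DifferentiableAt.fun_sum fun j _ =>
    (differentiableAt_marginalCov_inv_mulVec hβ hγ y j).const_mul _

/-- The partial derivatives of the objective. Both terms are differentiable and lie on one side of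
their tangents, which identifies the derivatives. -/
theorem hasDerivAt_evidenceObjective_update (hβ : 0 < β) {γ : Fin n → ℝ} (hγ : ∀ i, 0 ≤ γ i)
    {i : Fin n} (hi : 0 < γ i) :
    HasDerivAt (fun s => evidenceObjective F y β (Function.update γ i s))
      (columnForm F β γ i - backProjection F y β γ i ^ 2) (γ i) := by
  have hself : Function.update γ i (γ i) = γ := Function.update_eq_self i γ
  have hupd : DifferentiableAt ℝ (fun s => Function.update γ i s) (γ i) :=
    (hasFDerivAt_update γ (γ i)).differentiableAt
  have hnonneg : ∀ᶠ s in 𝓝 (γ i), ∀ k, 0 ≤ Function.update γ i s k := by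
    filter_upwards [lt_mem_nhds hi] with s hs k
    by_cases h : k = i
    · subst h; simpa using hs.le
    · simpa [h] using hγ k
  have hsum : ∀ (c : Fin n → ℝ) (s : ℝ),
      ∑ k, c k * (Function.update γ i s k - γ k) = c i * (s - γ i) := fun c s => by
    rw [Finset.sum_eq_single i (fun k _ hk => by simp [hk]) (by simp)]
    simp
  have hg : DifferentiableAt ℝ (fun s => logDetTerm F β (Function.update γ i s)) (γ i) := by
    refine DifferentiableAt.comp (γ i) (g := logDetTerm F β) ?_ hupd
    rw [hself]
    exact differentiableAt_logDetTerm hβ hγ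
  have hq : DifferentiableAt ℝ
      (fun s => y ⬝ᵥ ((marginalCov F β (Function.update γ i s))⁻¹ *ᵥ y)) (γ i) := by
    refine DifferentiableAt.comp (γ i) (g := fun γ => y ⬝ᵥ ((marginalCov F β γ)⁻¹ *ᵥ y)) ?_ hupd
    rw [hself]
    exact DifferentiableAt.fun_sum fun j _ =>
      (differentiableAt_marginalCov_inv_mulVec hβ hγ y j).const_mul _
  have hlin : ∀ c : ℝ, HasDerivAt (fun s : ℝ => c * s) c (γ i) := fun c => by
    simpa using (hasDerivAt_id (γ i)).const_mul c
  have hmax : IsLocalMax (fun s => logDetTerm F β (Function.update γ i s) -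
      columnForm F β γ i * s) (γ i) := by
    filter_upwards [hnonneg] with s hs
    have := logDetTerm_le_add_sum (F := F) hβ hγ hs
    rw [hsum] at this
    rw [hself]
    linarith
  have hmin : IsLocalMin (fun s => y ⬝ᵥ ((marginalCov F β (Function.update γ i s))⁻¹ *ᵥ y) +
      backProjection F y β γ i ^ 2 * s) (γ i) := by
    filter_upwards [hnonneg] with s hs
    have := dotProduct_marginalCov_inv_ge (F := F) (y := y) hβ hγ hs
    rw [hsum fun k => backProjection F y β γ k ^ 2] at this
    rw [hself]
    linarith
  have h1 := hmax.hasDerivAt_eq_zero (hg.hasDerivAt.sub (hlin (columnForm F β γ i)))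
  have h2 := hmin.hasDerivAt_eq_zero (hq.hasDerivAt.add (hlin (backProjection F y β γ i ^ 2)))
  exact (hq.hasDerivAt.add hg.hasDerivAt).congr_deriv (by linarith)

end Objective

/-! ### Runs of the iteration -/

section Runs

variable {m n : ℕ} {F : Matrix (Fin m) (Fin n) ℝ} {y : Fin m → ℝ} {β τ : ℝ} {γ₀ : Fin n → ℝ}

theorem invSq_le_iff {θ : Fin n → ℝ} (hθ : θ ∈ posOrthant n) {i : Fin n} {c : ℝ} :
    invSq θ i ≤ c ↔ 1 ≤ c * θ i ^ 2 :=
  inv_le_iff_one_le_mul₀ (pow_pos (hθ i) 2)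

theorem AMQRun.γ_pos (r : AMQRun F y β τ γ₀) (k : ℕ) (i : Fin n) : 0 < r.γ k i :=
  invSq_pos (r.θ_mem k) i

theorem AMQRun.x_eq (hβ : 0 < β) (r : AMQRun F y β τ γ₀) (k : ℕ) :
    r.x k = posteriorMean F y β (r.γ k) :=
  eq_posteriorMean hβ (r.γ_pos k) (r.x_update k)

theorem AMQRun.θHalf_sub (hβ : 0 < β) (hτ : 0 < τ) (r : AMQRun F y β τ γ₀) (k : ℕ) :
    r.θHalf k - r.θ k = amqDir F y β τ (r.θ k) := by
  rw [eq_proxPoint hβ hτ (r.x k) (r.θ_mem k) (r.θHalf_update k), r.x_eq hβ]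
  rfl

theorem AMQRun.θ_succ (hβ : 0 < β) (hτ : 0 < τ) (r : AMQRun F y β τ γ₀) (k : ℕ) :
    r.θ (k + 1) = r.θ k + r.η k • amqDir F y β τ (r.θ k) := by
  rw [r.θ_update, r.θHalf_sub hβ hτ]

/-- The iterates of the AMQ iteration with a step size `e k θ` that may depend on the current
iterate `θ`. -/
noncomputable def amqSeq (F : Matrix (Fin m) (Fin n) ℝ) (y : Fin m → ℝ) (β τ : ℝ)
    (θ₀ : Fin n → ℝ) (e : ℕ → (Fin n → ℝ) → ℝ) : ℕ → Fin n → ℝ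
  | 0 => θ₀
  | k + 1 => amqSeq F y β τ θ₀ e k +
      e k (amqSeq F y β τ θ₀ e k) • amqDir F y β τ (amqSeq F y β τ θ₀ e k)

/-- The run whose iterates `θ` are prescribed. -/
noncomputable def AMQRun.ofIterates (hβ : 0 < β) (hτ : 0 < τ) (θ : ℕ → Fin n → ℝ) (η : ℕ → ℝ)
    (hη : ∀ k, 0 < η k) (hθ : ∀ k, θ k ∈ posOrthant n) (hinit : invSq (θ 0) = γ₀)
    (hsucc : ∀ k, θ (k + 1) = θ k + η k • amqDir F y β τ (θ k)) : AMQRun F y β τ γ₀ where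
  η := η
  θ := θ
  θHalf k := proxPoint F β τ (posteriorMean F y β (invSq (θ k))) (θ k)
  x k := posteriorMean F y β (invSq (θ k))
  η_pos := hη
  θ_mem := hθ
  init := hinit
  x_update k := isMinOn_posteriorMean hβ (invSq_pos (hθ k))
  θHalf_mem k := proxPoint_mem hβ hτ _ (hθ k)
  θHalf_update k := isMinOn_proxPoint hβ hτ _ (hθ k)
  θ_update := hsucc

/-- From every point some step does not increase the objective. -/
theorem exists_descent_step (hβ : 0 < β) (hτ : 0 < τ) {θ : Fin n → ℝ} (hθ : θ ∈ posOrthant n) :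
    ∃ s : ℝ, 0 < s ∧ θ + s • amqDir F y β τ θ ∈ posOrthant n ∧
      evidenceObjective F y β (invSq (θ + s • amqDir F y β τ θ)) ≤
        evidenceObjective F y β (invSq θ) := by
  set d := amqDir F y β τ θ
  set x := posteriorMean F y β (invSq θ)
  have h1 : ∀ i, ∀ᶠ s in 𝓝[>] (0 : ℝ), θ i / 2 < θ i + s * d i := fun i => by
    have hc : ContinuousAt (fun s : ℝ => θ i + s * d i) 0 := by fun_prop
    refine (hc.eventually (lt_mem_nhds ?_)).filter_mono nhdsWithin_le_nhds
    simpa using hθ i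
  have h2 : ∀ i, ∀ᶠ s in 𝓝[>] (0 : ℝ),
      s * (x i ^ 2 + 3 / 2 * (4 * invSq θ i)) < 2 * x i ^ 2 + τ := fun i => by
    have hc : ContinuousAt (fun s : ℝ => s * (x i ^ 2 + 3 / 2 * (4 * invSq θ i))) 0 := by fun_prop
    refine (hc.eventually (gt_mem_nhds ?_)).filter_mono nhdsWithin_le_nhds
    simp only [zero_mul]
    positivity
  obtain ⟨s, hs1, hs2, hs⟩ :=
    ((eventually_all.mpr h1).and ((eventually_all.mpr h2).and self_mem_nhdsWithin)).exists
  replace hs : 0 < s := hs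
  have hmem : θ + s • d ∈ posOrthant n := fun i => lt_trans (half_pos (hθ i)) (hs1 i)
  refine ⟨s, hs, hmem, ?_⟩
  have h3 := evidenceObjective_step_le (C := fun i => 4 * invSq θ i) hβ hτ hθ hmem
    (fun i => by linarith [invSq_pos hθ i]) (fun i => by
      rw [invSq_le_iff hmem]
      have h4 : invSq θ i * θ i ^ 2 = 1 := inv_mul_cancel₀ (pow_pos (hθ i) 2).ne'
      have h5 : (θ i / 2) ^ 2 ≤ (θ + s • d) i ^ 2 :=
        pow_le_pow_left₀ (half_pos (hθ i)).le (hs1 i).le 2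
      have h6 := mul_le_mul_of_nonneg_left h5 (invSq_pos hθ i).le
      linarith)
  refine h3.trans (add_le_of_nonpos_right (Finset.sum_nonpos fun i _ => ?_))
  refine mul_nonpos_of_nonpos_of_nonneg ?_ (sq_nonneg _)
  have h4 := mul_le_mul_of_nonneg_left (hs2 i).le hs.le
  linarith

/-- Any initial segment of a run along which the objective does not increase, followed by one more
such step of arbitrary length, extends to a run along which the objective never increases. -/
theorem AMQRun.exists_descending_extension (hβ : 0 < β) (hτ : 0 < τ) (r : AMQRun F y β τ γ₀)
    {K : ℕ} (hK : ∀ j < K, r.objective (j + 1) ≤ r.objective j) {s : ℝ} (hs : 0 < s)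
    (hmem : r.θ K + s • amqDir F y β τ (r.θ K) ∈ posOrthant n)
    (hle : evidenceObjective F y β (invSq (r.θ K + s • amqDir F y β τ (r.θ K))) ≤
      evidenceObjective F y β (invSq (r.θ K))) :
    ∃ r' : AMQRun F y β τ γ₀, (∀ k, r'.objective (k + 1) ≤ r'.objective k) ∧
      r'.θ K = r.θ K ∧ r'.θ (K + 1) = r.θ K + s • amqDir F y β τ (r.θ K) := by
  classical
  have hσ : ∀ θ : Fin n → ℝ, ∃ s : ℝ, θ ∈ posOrthant n → 0 < s ∧
      θ + s • amqDir F y β τ θ ∈ posOrthant n ∧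
      evidenceObjective F y β (invSq (θ + s • amqDir F y β τ θ)) ≤
        evidenceObjective F y β (invSq θ) := fun θ => by
    by_cases hθ : θ ∈ posOrthant n
    · obtain ⟨s, h⟩ := exists_descent_step (F := F) (y := y) hβ hτ hθ
      exact ⟨s, fun _ => h⟩
    · exact ⟨0, fun h => absurd h hθ⟩
  choose σ hσ using hσ
  -- The step sizes of `r` before `K`, the prescribed length at `K`, descent steps afterwards.
  set e : ℕ → (Fin n → ℝ) → ℝ := fun k θ => if k < K then r.η k else if k = K then s else σ θ
    with he
  set θ := amqSeq F y β τ (r.θ 0) e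
  have hsucc : ∀ k, θ (k + 1) = θ k + e k (θ k) • amqDir F y β τ (θ k) := fun k => rfl
  have hpre : ∀ k ≤ K, θ k = r.θ k := by
    intro k
    induction k with
    | zero => exact fun _ => rfl
    | succ k ih =>
      intro hk
      have hlt : k < K := hk
      rw [hsucc, ih hlt.le, r.θ_succ hβ hτ]
      simp [he, hlt]
  have hK1 : θ (K + 1) = r.θ K + s • amqDir F y β τ (r.θ K) := by
    rw [hsucc, hpre K le_rfl]
    simp [he]
  have hstep : ∀ k, θ k ∈ posOrthant n → 0 < e k (θ k) ∧ θ (k + 1) ∈ posOrthant n ∧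
      evidenceObjective F y β (invSq (θ (k + 1))) ≤ evidenceObjective F y β (invSq (θ k)) := by
    intro k hk
    rcases lt_trichotomy k K with h | h | h
    · rw [hpre k h.le, hpre (k + 1) h]
      refine ⟨?_, r.θ_mem _, hK k h⟩
      simpa [he, h] using r.η_pos k
    · subst h
      rw [hK1, hpre k le_rfl]
      refine ⟨?_, hmem, hle⟩
      simpa [he] using hs
    · have hek : e k (θ k) = σ (θ k) := by simp [he, h.not_gt, h.ne']
      rw [hsucc, hek]
      exact hσ (θ k) hk
  have hθmem : ∀ k, θ k ∈ posOrthant n := fun k => by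
    induction k with
    | zero => exact r.θ_mem 0
    | succ k ih => exact (hstep k ih).2.1
  exact ⟨AMQRun.ofIterates hβ hτ θ (fun k => e k (θ k)) (fun k => (hstep k (hθmem k)).1) hθmem
    r.init hsucc, fun k => (hstep k (hθmem k)).2.2, hpre K le_rfl, hK1⟩

/-- A vanishing column of `F` decouples its coordinate from the objective, and the iteration does
not move that coordinate. -/
theorem amqDir_eq_zero_of_column (hτ : 0 < τ) {i : Fin n} (hi : ∀ j, F j i = 0) (θ : Fin n → ℝ) :
    amqDir F y β τ θ i = 0 := by
  have hx : posteriorMean F y β (invSq θ) i = 0 := by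
    simp [posteriorMean, backProjection, mulVec, dotProduct, hi]
  have hg : negGrad F β θ i = 0 := by simp [negGrad, columnForm_eq_zero hi]
  simp [amqDir, proxPoint, hx, hg, hτ.ne']

theorem AMQRun.γ_zero (r : AMQRun F y β τ γ₀) : r.γ 0 = γ₀ := r.init

/-- Coordinates with a nonvanishing column are bounded by coercivity, the others are constant. -/
theorem exists_isIterateBound (hβ : 0 < β) (hτ : 0 < τ) (hγ₀ : γ₀ ∈ posOrthant n) :
    ∃ R, IsIterateBound F y β τ γ₀ R := by
  set c := evidenceObjective F y β γ₀
  have hβm : 0 < β⁻¹ ^ m * β := mul_pos (pow_pos (inv_pos.mpr hβ) m) hβ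
  -- For a vanishing column the quotient is `_ / 0 = 0`, and the bound is the initial value.
  set ρ : Fin n → ℝ := fun i => γ₀ i + Real.exp c / (β⁻¹ ^ m * β * ∑ j, F j i ^ 2)
  have hquot : ∀ i, 0 ≤ Real.exp c / (β⁻¹ ^ m * β * ∑ j, F j i ^ 2) := fun i =>
    div_nonneg (Real.exp_pos c).le (mul_nonneg hβm.le (Finset.sum_nonneg fun j _ => sq_nonneg _))
  have hρ0 : ∀ i ∈ Finset.univ, 0 ≤ ρ i := fun i _ => add_nonneg (hγ₀ i).le (hquot i)
  refine ⟨1 + ∑ i, ρ i, by linarith [Finset.sum_nonneg hρ0], fun r hr k i => ?_⟩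
  have hsum : ρ i ≤ ∑ i, ρ i := Finset.single_le_sum hρ0 (Finset.mem_univ i)
  suffices r.γ k i ≤ ρ i by linarith
  have hobj : evidenceObjective F y β (r.γ k) ≤ c := by
    have := antitone_nat_of_succ_le hr (Nat.zero_le k)
    simpa only [AMQRun.objective, r.γ_zero] using this
  rcases (Finset.sum_nonneg fun j (_ : j ∈ Finset.univ) => sq_nonneg (F j i)).lt_or_eq with h | h
  · exact (le_of_evidenceObjective_le hβ (fun i => (r.γ_pos k i).le) hobj h).trans
      (le_add_of_nonneg_left (hγ₀ i).le)
  · have hF : ∀ j, F j i = 0 := fun j => pow_eq_zero_iff two_ne_zero |>.mp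
      ((Finset.sum_eq_zero_iff_of_nonneg fun j _ => sq_nonneg (F j i)).mp h.symm j
        (Finset.mem_univ j))
    have hconst : ∀ k, r.θ k i = r.θ 0 i := fun k => by
      induction k with
      | zero => rfl
      | succ k ih =>
        rw [r.θ_succ hβ hτ, Pi.add_apply, Pi.smul_apply, amqDir_eq_zero_of_column hτ hF, smul_zero,
          add_zero, ih]
    have hγk : r.γ k i = γ₀ i := by
      refine Eq.trans ?_ (congrFun r.init i)
      simp only [AMQRun.γ, invSq, hconst k]
    rw [hγk]
    exact le_add_of_nonneg_right (hquot i)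

end Runs

/-! ### Monotonicity -/

section Monotone

variable {m n : ℕ} {F : Matrix (Fin m) (Fin n) ℝ} {y : Fin m → ℝ} {β τ : ℝ} {γ₀ : Fin n → ℝ}

/-- `A_k` for the step of length `s` from `θ`. -/
noncomputable def stepA (F : Matrix (Fin m) (Fin n) ℝ) (y : Fin m → ℝ) (β τ : ℝ)
    (θ : Fin n → ℝ) (s : ℝ) : ℝ :=
  s * ∑ i, (posteriorMean F y β (invSq θ) i ^ 2 + τ) * amqDir F y β τ θ i ^ 2

/-- `B_k` for the step of length `s` from `θ`. -/
noncomputable def stepB (F : Matrix (Fin m) (Fin n) ℝ) (y : Fin m → ℝ) (β τ : ℝ)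
    (θ : Fin n → ℝ) (R s : ℝ) : ℝ :=
  s ^ 2 * ∑ i, (posteriorMean F y β (invSq θ) i ^ 2 + 9 * R / 5) * amqDir F y β τ θ i ^ 2

theorem AMQRun.A_eq (hβ : 0 < β) (hτ : 0 < τ) (r : AMQRun F y β τ γ₀) (k : ℕ) :
    r.A k = stepA F y β τ (r.θ k) (r.η k) := by
  simp only [AMQRun.A, stepA, r.x_eq hβ, AMQRun.γ, ← r.θHalf_sub hβ hτ, Pi.sub_apply]

theorem AMQRun.B_eq (hβ : 0 < β) (hτ : 0 < τ) (r : AMQRun F y β τ γ₀) (R : ℝ) (k : ℕ) :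
    r.B R k = stepB F y β τ (r.θ k) R (r.η k) := by
  simp only [AMQRun.B, stepB, r.x_eq hβ, AMQRun.γ, ← r.θHalf_sub hβ hτ, Pi.sub_apply]

/-- The curvature constant `3/2` leaves room for exceeding the bound `R` by a factor `6/5`. -/
theorem evidenceObjective_step_le_sub (hβ : 0 < β) (hτ : 0 < τ) {θ : Fin n → ℝ} {R s : ℝ}
    (hs : 0 ≤ s) (hθ : θ ∈ posOrthant n) (hθ' : θ + s • amqDir F y β τ θ ∈ posOrthant n)
    (hC : ∀ i, invSq θ i ≤ 6 / 5 * R)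
    (hC' : ∀ i, invSq (θ + s • amqDir F y β τ θ) i ≤ 6 / 5 * R) :
    evidenceObjective F y β (invSq (θ + s • amqDir F y β τ θ)) ≤
      evidenceObjective F y β (invSq θ) - stepA F y β τ θ s + stepB F y β τ θ R s := by
  refine (evidenceObjective_step_le hβ hτ hθ hθ' hC hC').trans ?_
  rw [stepA, stepB, sub_add_eq_add_sub, add_sub_assoc, Finset.mul_sum, Finset.mul_sum,
    ← Finset.sum_sub_distrib]
  refine add_le_add_right (Finset.sum_le_sum fun i _ => ?_) _
  have : 0 ≤ s * (posteriorMean F y β (invSq θ) i ^ 2 * amqDir F y β τ θ i ^ 2) := by positivity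
  linarith

theorem stepB_le_stepA_of_le {θ : Fin n → ℝ} {R s η : ℝ} (hs : 0 ≤ s) (hsη : s ≤ η) (hη : 0 < η)
    (hR : 0 < R) (h : stepB F y β τ θ R η ≤ stepA F y β τ θ η) :
    stepB F y β τ θ R s ≤ stepA F y β τ θ s := by
  rw [stepA, stepB] at h ⊢
  set a := ∑ i, (posteriorMean F y β (invSq θ) i ^ 2 + τ) * amqDir F y β τ θ i ^ 2
  set b := ∑ i, (posteriorMean F y β (invSq θ) i ^ 2 + 9 * R / 5) * amqDir F y β τ θ i ^ 2
  have hb : 0 ≤ b := Finset.sum_nonneg fun i _ => by positivity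
  have h1 : η * b ≤ a := le_of_mul_le_mul_left (by linarith) hη
  have h2 : s * b ≤ a := (mul_le_mul_of_nonneg_right hsη hb).trans h1
  have h3 := mul_le_mul_of_nonneg_left h2 hs
  linarith

theorem add_smul_mem_posOrthant {θ d : Fin n → ℝ} {s η : ℝ} (hs : 0 ≤ s) (hsη : s ≤ η)
    (hθ : θ ∈ posOrthant n) (hη : θ + η • d ∈ posOrthant n) : θ + s • d ∈ posOrthant n := by
  intro i
  have h1 : 0 < θ i := hθ i
  have h2 : 0 < θ i + η * d i := hη i
  change 0 < θ i + s * d i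
  rcases le_total 0 (d i) with h | h
  · exact add_pos_of_pos_of_nonneg h1 (mul_nonneg hs h)
  · exact h2.trans_le (add_le_add_right (mul_le_mul_of_nonpos_right hsη h) _)

/-- The iterate bound transfers to initial segments of runs. -/
theorem IsIterateBound.le_of_prefix {R : ℝ} (hR : IsIterateBound F y β τ γ₀ R) (hβ : 0 < β)
    (hτ : 0 < τ) (r : AMQRun F y β τ γ₀) {K : ℕ}
    (hK : ∀ j < K, r.objective (j + 1) ≤ r.objective j) (i : Fin n) : r.γ K i ≤ R := by
  obtain ⟨s, hs, hmem, hle⟩ := exists_descent_step (F := F) (y := y) hβ hτ (r.θ_mem K)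
  obtain ⟨r', hr', hrK, -⟩ := r.exists_descending_extension hβ hτ hK hs hmem hle
  have := hR.2 r' hr' K i
  rwa [AMQRun.γ, hrK] at this

/-- Along the segment from `θ^(K)` to `θ^(K+1)` the values `γ` cannot leave `[0, R]`: as long as
they stay below `6 R / 5`, the objective does not exceed its value at `θ^(K)`, so the truncated step
belongs to a run along which the objective never increases, and the values are at most `R`. -/
theorem IsIterateBound.objective_succ_le {R : ℝ} (hR : IsIterateBound F y β τ γ₀ R) (hβ : 0 < β)
    (hτ : 0 < τ) (r : AMQRun F y β τ γ₀) {K : ℕ}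
    (hK : ∀ j < K, r.objective (j + 1) ≤ r.objective j) (hBA : r.B R K ≤ r.A K) :
    r.objective (K + 1) ≤ r.objective K := by
  rw [r.A_eq hβ hτ, r.B_eq hβ hτ] at hBA
  have hR0 : 0 < R := hR.1
  have hθ := r.θ_mem K
  have hη := r.η_pos K
  have hsucc := r.θ_succ hβ hτ K
  have hmem1 := r.θ_mem (K + 1)
  rw [hsucc] at hmem1
  have hγK : ∀ i, invSq (r.θ K) i ≤ R := hR.le_of_prefix hβ hτ r hK
  set θ := r.θ K
  set η := r.η K
  set d := amqDir F y β τ θ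
  have hmem : ∀ s, 0 ≤ s → s ≤ η → θ + s • d ∈ posOrthant n := fun s hs hsη =>
    add_smul_mem_posOrthant hs hsη hθ hmem1
  have hdesc : ∀ s, 0 ≤ s → s ≤ η → (∀ i, invSq (θ + s • d) i ≤ 6 / 5 * R) →
      evidenceObjective F y β (invSq (θ + s • d)) ≤ evidenceObjective F y β (invSq θ) := by
    intro s hs hsη hsR
    have h1 := evidenceObjective_step_le_sub hβ hτ hs hθ (hmem s hs hsη)
      (fun i => (hγK i).trans (by linarith)) hsR
    linarith [stepB_le_stepA_of_le hs hsη hη hR0 hBA]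
  have himprove : ∀ s, 0 < s → s ≤ η → (∀ i, invSq (θ + s • d) i ≤ 6 / 5 * R) →
      ∀ i, invSq (θ + s • d) i ≤ R := by
    intro s hs hsη hsR i
    obtain ⟨r', hr', -, hrK⟩ := r.exists_descending_extension hβ hτ hK hs (hmem s hs.le hsη)
      (hdesc s hs.le hsη hsR)
    have := hR.2 r' hr' (K + 1) i
    rwa [AMQRun.γ, hrK] at this
  set T : Set ℝ := {s | ∀ i, 1 ≤ R * (θ i + s * d i) ^ 2} with hT
  have hTiff : ∀ s, 0 ≤ s → s ≤ η → (s ∈ T ↔ ∀ i, invSq (θ + s • d) i ≤ R) := fun s hs hsη =>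
    forall_congr' fun i => (invSq_le_iff (hmem s hs hsη)).symm
  have hTclosed : IsClosed T := by
    have : T = ⋂ i, {s | 1 ≤ R * (θ i + s * d i) ^ 2} := by
      ext s
      simp [hT]
    rw [this]
    exact isClosed_iInter fun i => isClosed_le continuous_const (by fun_prop)
  have h0 : (0 : ℝ) ∈ T := (hTiff 0 le_rfl hη.le).mpr (by simpa using hγK)
  have hIcc : Set.Icc 0 η ⊆ T := by
    refine (hTclosed.inter isClosed_Icc).Icc_subset_of_forall_mem_nhdsWithin h0 ?_
    rintro s ⟨hsT, hs0, hsη⟩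
    have hev : ∀ i, ∀ᶠ s' in 𝓝[>] s, 1 < 6 / 5 * R * (θ i + s' * d i) ^ 2 := fun i => by
      have hc : ContinuousAt (fun s' : ℝ => 6 / 5 * R * (θ i + s' * d i) ^ 2) s := by fun_prop
      refine (hc.eventually (lt_mem_nhds ?_)).filter_mono nhdsWithin_le_nhds
      have : 1 ≤ R * (θ i + s * d i) ^ 2 := hsT i
      linarith
    filter_upwards [eventually_all.mpr hev, Ioc_mem_nhdsGT hsη] with s' h1 h2
    have hs' : 0 < s' := hs0.trans_lt h2.1
    exact (hTiff s' hs'.le h2.2).mpr (himprove s' hs' h2.2 fun i =>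
      (invSq_le_iff (hmem s' hs'.le h2.2)).mpr (h1 i).le)
  have hηT := (hTiff η hη.le le_rfl).mp (hIcc ⟨hη.le, le_rfl⟩)
  have := hdesc η hη.le le_rfl fun i => (hηT i).trans (by linarith)
  rwa [← hsucc] at this

theorem IsIterateBound.antitone_objective {R : ℝ} (hR : IsIterateBound F y β τ γ₀ R) (hβ : 0 < β)
    (hτ : 0 < τ) (r : AMQRun F y β τ γ₀) (hBA : ∀ k, r.B R k ≤ r.A k) : Antitone r.objective := by
  refine antitone_nat_of_succ_le fun k => ?_
  induction k using Nat.strong_induction_on with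
  | _ k ih => exact hR.objective_succ_le hβ hτ r ih (hBA k)

theorem AMQRun.logDetTerm_zero_le_objective (hβ : 0 < β) (r : AMQRun F y β τ γ₀) (k : ℕ) :
    logDetTerm F β 0 ≤ r.objective k :=
  logDetTerm_zero_le_evidenceObjective hβ fun i => (r.γ_pos k i).le

/-- Sufficient decrease, once all values `γ` are known to be at most `R`. -/
theorem AMQRun.objective_succ_le_sub (hβ : 0 < β) (hτ : 0 < τ) (r : AMQRun F y β τ γ₀) {R : ℝ}
    (hR : 0 < R) (hγ : ∀ k i, r.γ k i ≤ R) (k : ℕ) :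
    r.objective (k + 1) ≤ r.objective k - r.A k + r.B R k := by
  have hsucc := r.θ_succ hβ hτ k
  have hmem := r.θ_mem (k + 1)
  have hγ1 := hγ (k + 1)
  rw [AMQRun.γ, hsucc] at hγ1
  rw [hsucc] at hmem
  have := evidenceObjective_step_le_sub (R := R) hβ hτ (r.η_pos k).le (r.θ_mem k) hmem
    (fun i => (hγ k i).trans (by linarith)) (fun i => (hγ1 i).trans (by linarith))
  rw [r.A_eq hβ hτ, r.B_eq hβ hτ]
  rwa [← hsucc] at this

end Monotone

/-! ### Accumulation points and stationarity -/

section Accumulation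

variable {m n : ℕ} {F : Matrix (Fin m) (Fin n) ℝ} {y : Fin m → ℝ} {β τ : ℝ} {γ₀ : Fin n → ℝ}

theorem AMQRun.x_sq_le (r : AMQRun F y β τ γ₀) (hβ : 0 < β) {R : ℝ}
    (hγ : ∀ k i, r.γ k i ≤ R) (k : ℕ) (i : Fin n) :
    r.x k i ^ 2 ≤ R * (β * ∑ j, y j ^ 2) := by
  have h := isMinOn_iff.mp (r.x_update k) 0 (Set.mem_univ _)
  have h0 : auxObjective F y β 0 (invSq (r.θ k)) = β * ∑ j, y j ^ 2 := by
    simp [auxObjective]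
  rw [h0] at h
  have h1 : r.x k i ^ 2 / r.γ k i ≤ ∑ i, r.x k i ^ 2 / r.γ k i :=
    Finset.single_le_sum (f := fun i => r.x k i ^ 2 / r.γ k i)
      (fun i _ => div_nonneg (sq_nonneg _) (r.γ_pos k i).le) (Finset.mem_univ i)
  have h2 : 0 ≤ β * ∑ j, ((F *ᵥ r.x k) j - y j) ^ 2 :=
    mul_nonneg hβ.le (Finset.sum_nonneg fun j _ => sq_nonneg _)
  have h3 : r.x k i ^ 2 / r.γ k i ≤ β * ∑ j, y j ^ 2 := by
    refine h1.trans (le_trans ?_ h)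
    exact le_add_of_nonneg_left h2
  rw [div_le_iff₀ (r.γ_pos k i)] at h3
  have h4 : 0 ≤ β * ∑ j, y j ^ 2 := mul_nonneg hβ.le (Finset.sum_nonneg fun j _ => sq_nonneg _)
  linarith [mul_le_mul_of_nonneg_left (hγ k i) h4]

theorem AMQRun.exists_convergent_subsequence (r : AMQRun F y β τ γ₀) (hβ : 0 < β) {R : ℝ}
    (hγ : ∀ k i, r.γ k i ≤ R) :
    ∃ φ : ℕ → ℕ, StrictMono φ ∧
      (∃ xlim : Fin n → ℝ, Tendsto (fun k => r.x (φ k)) atTop (𝓝 xlim)) ∧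
      ∃ γlim : Fin n → ℝ, Tendsto (fun k => r.γ (φ k)) atTop (𝓝 γlim) := by
  set M := Real.sqrt (R * (β * ∑ j, y j ^ 2))
  have hcompact : IsCompact ((Set.Icc (fun _ => -M) (fun _ => M) : Set (Fin n → ℝ)) ×ˢ
      (Set.Icc (fun _ => 0) (fun _ => R) : Set (Fin n → ℝ))) := isCompact_Icc.prod isCompact_Icc
  have hmem : ∀ k, (r.x k, r.γ k) ∈ (Set.Icc (fun _ => -M) (fun _ => M) : Set (Fin n → ℝ)) ×ˢ
      (Set.Icc (fun _ => 0) (fun _ => R) : Set (Fin n → ℝ)) := fun k => by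
    have hx : ∀ i, |r.x k i| ≤ M := fun i => Real.abs_le_sqrt (r.x_sq_le hβ hγ k i)
    exact ⟨⟨fun i => (abs_le.mp (hx i)).1, fun i => (abs_le.mp (hx i)).2⟩,
      ⟨fun i => (r.γ_pos k i).le, fun i => hγ k i⟩⟩
  obtain ⟨p, -, φ, hφ, hp⟩ := hcompact.tendsto_subseq hmem
  exact ⟨φ, hφ, ⟨p.1, (continuous_fst.tendsto p).comp hp⟩,
    ⟨p.2, (continuous_snd.tendsto p).comp hp⟩⟩

/-- If `∑ ηₖ aₖ` converges and `∑ ηₖ` diverges, then `0` is a cluster value of `a`. -/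
theorem exists_tendsto_zero_of_summable_mul {η a : ℕ → ℝ} (hη : ∀ k, 0 ≤ η k) (ha : ∀ k, 0 ≤ a k)
    (hsum : Summable fun k => η k * a k) (hdiv : ¬ Summable η) :
    ∃ ψ : ℕ → ℕ, Tendsto ψ atTop atTop ∧ Tendsto (fun k => a (ψ k)) atTop (𝓝 0) := by
  have key : ∀ N : ℕ, ∃ k, N ≤ k ∧ a k < 1 / ((N : ℝ) + 1) := by
    intro N
    by_contra! hcon
    refine hdiv ((summable_nat_add_iff N).mp ?_)
    have hN : (0 : ℝ) < (N : ℝ) + 1 := by positivity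
    refine Summable.of_nonneg_of_le (fun k => hη _) (fun k => ?_)
      (((summable_nat_add_iff N).mpr hsum).mul_left ((N : ℝ) + 1))
    have h1 := mul_le_mul_of_nonneg_left (hcon (k + N) (Nat.le_add_left N k)) (hη (k + N))
    rw [mul_one_div, div_le_iff₀ hN] at h1
    linarith
  choose ψ hψ1 hψ2 using key
  exact ⟨ψ, tendsto_atTop_mono hψ1 tendsto_id,
    squeeze_zero (fun k => ha _) (fun k => (hψ2 k).le) tendsto_one_div_add_atTop_nhds_zero_nat⟩

theorem AMQRun.summable_A (r : AMQRun F y β τ γ₀) (hβ : 0 < β) (hτ : 0 < τ) {R κ : ℝ} (hR : 0 < R)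
    (hγ : ∀ k i, r.γ k i ≤ R) (hκ : κ < 1) (hBA : ∀ k, r.B R k ≤ κ * r.A k) : Summable r.A := by
  have hA : ∀ k, 0 ≤ r.A k := fun k =>
    mul_nonneg (r.η_pos k).le (Finset.sum_nonneg fun i _ => by positivity)
  have hstep : ∀ k, (1 - κ) * r.A k ≤ r.objective k - r.objective (k + 1) := fun k => by
    linarith [r.objective_succ_le_sub hβ hτ hR hγ k, hBA k]
  refine summable_of_sum_range_le (c := (r.objective 0 - logDetTerm F β 0) / (1 - κ)) hA fun N => ?_
  rw [le_div_iff₀ (by linarith), mul_comm, Finset.mul_sum]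
  refine (Finset.sum_le_sum fun k _ => hstep k).trans ?_
  rw [Finset.sum_range_sub']
  linarith [r.logDetTerm_zero_le_objective hβ N]

/-- The stationarity condition of the half step, multiplied by `θᵢ` and with `θᵢ² = 1 / γᵢ`. -/
theorem amqDir_stationary (hτ : 0 < τ) {θ : Fin n → ℝ} (hθ : θ ∈ posOrthant n) (i : Fin n) :
    2 * invSq θ i * backProjection F y β (invSq θ) i ^ 2 +
      (2 * (invSq θ i * backProjection F y β (invSq θ) i) ^ 2 + τ) *
        (amqDir F y β τ θ i * Real.sqrt (invSq θ i)⁻¹) =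
      2 * invSq θ i * columnForm F β (invSq θ) i := by
  have hpos : 0 < θ i := hθ i
  have h := proxPoint_stationary (F := F) (β := β) hτ (posteriorMean F y β (invSq θ)) θ i
  have hd : proxPoint F β τ (posteriorMean F y β (invSq θ)) θ i = θ i + amqDir F y β τ θ i := by
    simp [amqDir]
  have hsqrt : Real.sqrt (invSq θ i)⁻¹ = θ i := by
    rw [invSq, inv_inv, Real.sqrt_sq hpos.le]
  have hγ : invSq θ i * θ i ^ 2 = 1 := inv_mul_cancel₀ (pow_pos hpos 2).ne'
  rw [hd, negGrad, posteriorMean, eq_div_iff hpos.ne'] at h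
  rw [hsqrt]
  linear_combination h - 2 * invSq θ i * backProjection F y β (invSq θ) i ^ 2 * hγ

/-- Stationarity of accumulation points. Divergence of the step sizes along `φ` forces the
directions to vanish along a further sequence, and there the stationarity condition of the half
step passes to the limit. -/
theorem AMQRun.hasDerivAt_of_tendsto (r : AMQRun F y β τ γ₀) (hβ : 0 < β) (hτ : 0 < τ)
    (hA : Summable r.A) {φ : ℕ → ℕ} (hφ : StrictMono φ) {γlim : Fin n → ℝ}
    (hlim : Tendsto (fun k => r.γ (φ k)) atTop (𝓝 γlim))
    (hdiv : ¬ Summable fun k => r.η (φ k)) {i : Fin n} (hi : γlim i ≠ 0) :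
    HasDerivAt (fun s => evidenceObjective F y β (Function.update γlim i s)) 0 (γlim i) := by
  have hcoord : ∀ j, Tendsto (fun k => r.γ (φ k) j) atTop (𝓝 (γlim j)) := tendsto_pi_nhds.mp hlim
  have hnonneg : ∀ j, 0 ≤ γlim j := fun j => ge_of_tendsto' (hcoord j) fun k => (r.γ_pos _ j).le
  have hpos : 0 < γlim i := lt_of_le_of_ne (hnonneg i) (Ne.symm hi)
  -- `A_k = η_k a_k` along `φ`, and `a_k` dominates `τ` times the squared direction.
  set a : ℕ → ℝ := fun k => ∑ j, (r.x (φ k) j ^ 2 + τ) * (r.θHalf (φ k) j - r.θ (φ k) j) ^ 2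
  have ha : ∀ k, 0 ≤ a k := fun k => Finset.sum_nonneg fun j _ => by positivity
  obtain ⟨ψ, hψ, haψ⟩ := exists_tendsto_zero_of_summable_mul (fun k => (r.η_pos (φ k)).le) ha
    (hA.comp_injective hφ.injective) hdiv
  set γ : ℕ → Fin n → ℝ := fun k => r.γ (φ (ψ k))
  set d : ℕ → ℝ := fun k => amqDir F y β τ (r.θ (φ (ψ k))) i with hd
  have hd0 : Tendsto d atTop (𝓝 0) := by
    have h1 : ∀ k, d k ^ 2 ≤ a (ψ k) / τ := fun k => by
      have h2 : (r.x (φ (ψ k)) i ^ 2 + τ) * (r.θHalf (φ (ψ k)) i - r.θ (φ (ψ k)) i) ^ 2 ≤ a (ψ k) :=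
        Finset.single_le_sum (f := fun j =>
          (r.x (φ (ψ k)) j ^ 2 + τ) * (r.θHalf (φ (ψ k)) j - r.θ (φ (ψ k)) j) ^ 2)
          (fun j _ => by positivity) (Finset.mem_univ i)
      rw [← Pi.sub_apply, r.θHalf_sub hβ hτ] at h2
      rw [le_div_iff₀ hτ]
      have h3 : 0 ≤ r.x (φ (ψ k)) i ^ 2 * d k ^ 2 := by positivity
      simp only [hd] at h3 ⊢
      linarith
    have h2 : Tendsto (fun k => d k ^ 2) atTop (𝓝 0) :=
      squeeze_zero (fun k => sq_nonneg _) h1 (by simpa using haψ.div_const τ)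
    have h3 := (Real.continuous_sqrt.tendsto 0).comp h2
    simp only [Function.comp_def, Real.sqrt_sq_eq_abs, Real.sqrt_zero] at h3
    exact (tendsto_zero_iff_abs_tendsto_zero d).mpr h3
  have hγlim : Tendsto γ atTop (𝓝 γlim) := hlim.comp hψ
  have hγi : Tendsto (fun k => γ k i) atTop (𝓝 (γlim i)) := tendsto_pi_nhds.mp hγlim i
  have hb : Tendsto (fun k => backProjection F y β (γ k) i) atTop
      (𝓝 (backProjection F y β γlim i)) :=
    (continuousAt_backProjection hβ hnonneg i).tendsto.comp hγlim
  have hh : Tendsto (fun k => columnForm F β (γ k) i) atTop (𝓝 (columnForm F β γlim i)) :=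
    (continuousAt_columnForm hβ hnonneg i).tendsto.comp hγlim
  have hsqrt : Tendsto (fun k => Real.sqrt (γ k i)⁻¹) atTop (𝓝 (Real.sqrt (γlim i)⁻¹)) :=
    (Real.continuous_sqrt.tendsto _).comp (hγi.inv₀ hi)
  have hL := ((hγi.const_mul 2).mul (hb.pow 2)).add
    (((((hγi.mul hb).pow 2).const_mul 2).add_const τ).mul (hd0.mul hsqrt))
  have hR := (hγi.const_mul 2).mul hh
  have heq := tendsto_nhds_unique
    (hL.congr fun k => amqDir_stationary (F := F) (y := y) (β := β) hτ (r.θ_mem (φ (ψ k))) i) hR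
  rw [zero_mul, mul_zero, add_zero] at heq
  have h0 : backProjection F y β γlim i ^ 2 = columnForm F β γlim i :=
    mul_left_cancel₀ (mul_ne_zero two_ne_zero hi) heq
  have := hasDerivAt_evidenceObjective_update (F := F) (y := y) hβ hnonneg hpos
  rwa [h0, sub_self] at this

end Accumulation

theorem mainTheorem1 {m n : ℕ} (F : Matrix (Fin m) (Fin n) ℝ) (y : Fin m → ℝ) (β τ : ℝ)
    (hβ : 0 < β) (hτ : 0 < τ) (γ₀ : Fin n → ℝ) (hγ₀ : γ₀ ∈ posOrthant n) :
    (∃ R, IsIterateBound F y β τ γ₀ R) ∧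
    ∀ R, IsIterateBound F y β τ γ₀ R →
      ∀ r : AMQRun F y β τ γ₀, (∀ k, r.B R k ≤ r.A k) →
        (Antitone r.objective ∧ ∃ l : ℝ, Tendsto r.objective atTop (𝓝 l)) ∧
        (∃ φ : ℕ → ℕ, StrictMono φ ∧
          (∃ xlim : Fin n → ℝ, Tendsto (fun k => r.x (φ k)) atTop (𝓝 xlim)) ∧
          ∃ γlim : Fin n → ℝ, Tendsto (fun k => r.γ (φ k)) atTop (𝓝 γlim)) ∧
        (∀ φ : ℕ → ℕ, StrictMono φ →
          ∀ γlim : Fin n → ℝ, Tendsto (fun k => r.γ (φ k)) atTop (𝓝 γlim) →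
          ¬ Summable (fun k => r.η (φ k)) →
          (∃ κ : ℝ, 0 ≤ κ ∧ κ < 1 ∧ ∀ k, r.B R k ≤ κ * r.A k) →
          ∀ i, γlim i = 0 ∨
            HasDerivAt (fun s => evidenceObjective F y β (Function.update γlim i s)) 0
              (γlim i)) := by
  refine ⟨exists_isIterateBound hβ hτ hγ₀, fun R hR r hBA => ?_⟩
  have hanti := hR.antitone_objective hβ hτ r hBA
  have hγ : ∀ k i, r.γ k i ≤ R := hR.2 r fun k => hanti (Nat.le_succ k)
  refine ⟨⟨hanti, _, tendsto_atTop_ciInf hanti ⟨logDetTerm F β 0, ?_⟩⟩,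
    r.exists_convergent_subsequence hβ hγ, ?_⟩
  · rintro _ ⟨k, rfl⟩
    exact r.logDetTerm_zero_le_objective hβ k
  · rintro φ hφ γlim hlim hdiv ⟨κ, -, hκ, hBκ⟩ i
    exact or_iff_not_imp_left.mpr fun hi => r.hasDerivAt_of_tendsto hβ hτ
      (r.summable_A hβ hτ hR.1 hγ hκ hBκ) hφ hlim hdiv hi
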